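/- Setting. Let $m\ge 2$, $n\ge 1$, $d\ge 1$ be integers and $\sigma>0$. There are $m$ machines; for an unknown $\theta\in[-1,1]^d$ each machine holds $n$ samples, and all $mn$ samples are independent with law $N(\theta,\sigma^2 I_d)$. The machines run an interactive blackboard protocol $\Pi$ with public and private randomness (independent of each other and of the data): bits are written one after the other on a blackboard seen by all machines; the current content of the blackboard and the public randomness determine whether the protocol has ended and, if not, which machine writes the next bit, and this bit is an arbitrary measurable function of that machine's samples, its private randomness, the public randomness and the content of the blackboard. The transcript $Y\in\{0,1\}^*$ is the final content of the blackboard, $|Y|$ is its length (infinite if the run never ends), and an estimator is any map $\hat\theta:\{0,1\}^*\to\mathbb{R}^d$. The mean-squared loss and the communication cost are $$R=\sup_{\theta\in[-1,1]^d}\mathbb{E}\,\|\hat\theta(Y)-\theta\|_2^2\in[0,\infty],\qquad B=\sup_{\theta\in[-1,1]^d}\mathbb{E}\,|Y|\in[0,\infty].$$ Claim 1. There is an absolute constant $c>0$ such that for all such $m,n,d,\sigma$, all protocols $\Pi$ and all estimators $\hat\theta$, $$R\;\ge\; c\cdot\min\left\{\frac{d^2\sigma^2}{nB\log m},\ \frac{d\sigma^2}{n\log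 m},\ d\right\},$$ where the first term is $+\infty$ if $B=0$ and $0$ if $B=\infty$. Claim 2. For every $\kappa\in(0,1)$ there is a constant $c>0$, depending only on $\kappa$, such that for all such $m,n,d,\sigma$ with $\sigma^2\le\kappa\, mn$, all protocols $\Pi$ and all estimators $\hat\theta$: if $R\le \frac{d\sigma^2}{mn}$, then $B\ge c\,\frac{dm}{\log m}$. -/

import Mathlib

open MeasureTheory ProbabilityTheory
open scoped ENNReal NNReal

namespace DistributedMean

/-- The data of one machine: `n` samples in `ℝ^d`, where `x k i` is coordinate `i` of sample `k`. -/
abbrev Samples (n d : ℕ) : Type := Fin n → Fin d → ℝ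

/-- The law of one sample: the spherical Gaussian `N(θ, σ² I_d)`, that is, the product of the
one-dimensional Gaussians `N(θ i, σ²)`. -/
noncomputable def gaussianVec {d : ℕ} (σ : ℝ≥0) (θ : Fin d → ℝ) : Measure (Fin d → ℝ) :=
  Measure.pi fun i => gaussianReal (θ i) (σ ^ 2)

/-- The law of the whole input: each of `m` machines holds `n` samples, and all `m * n` samples are
independent with law `N(θ, σ² I_d)`. -/
noncomputable def dataLaw (m n : ℕ) {d : ℕ} (σ : ℝ≥0) (θ : Fin d → ℝ) :
    Measure (Fin m → Samples n d) :=
  Measure.pi fun _ => Measure.pi fun _ => gaussianVec σ θ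

/-- An interactive blackboard protocol for `m` machines with public and private randomness.
The messages are written on the blackboard bit by bit. The content `w` of the blackboard (a bit
string, oldest bit first) and the public randomness determine whether the protocol has ended and, if
it has not, which machine writes the next bit. That bit is an arbitrary (measurable) function of the
public randomness, of the private randomness and the samples of this machine, and of `w`. -/
structure Protocol (m n d : ℕ) where
  /-- The space of the public randomness. -/
  Pub : Type
  /-- The space of the private randomness of each machine. -/
  Priv : Fin m → Type
  [measurableSpacePub : MeasurableSpace Pub]
  [measurableSpacePriv : ∀ j, MeasurableSpace (Priv j)]
  /-- The law of the public randomness. -/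
  pubLaw : Measure Pub
  /-- The law of the private randomness of each machine. -/
  privLaw : ∀ j, Measure (Priv j)
  [isProbPub : IsProbabilityMeasure pubLaw]
  [isProbPriv : ∀ j, IsProbabilityMeasure (privLaw j)]
  /-- Has the protocol ended when the blackboard reads `w`? -/
  halt : Pub → List Bool → Bool
  /-- Which machine writes the next bit when the blackboard reads `w`? -/
  speaker : Pub → List Bool → Fin m
  /-- The bit that machine `j` writes when it is its turn and the blackboard reads `w`. -/
  bit : ∀ j, Pub → Priv j → Samples n d → List Bool → Bool
  measurable_halt : ∀ w, Measurable fun r => halt r w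
  measurable_speaker : ∀ w, Measurable fun r => speaker r w
  measurable_bit : ∀ j w,
    Measurable fun p : Pub × Priv j × Samples n d => bit j p.1 p.2.1 p.2.2 w

attribute [instance] Protocol.measurableSpacePub Protocol.measurableSpacePriv
  Protocol.isProbPub Protocol.isProbPriv

namespace Protocol

variable {m n d : ℕ}

/-- Everything that a run depends on: public randomness, private randomness, and the data. -/
abbrev Outcome (P : Protocol m n d) : Type :=
  P.Pub × (∀ j, P.Priv j) × (Fin m → Samples n d)

/-- The joint law of public randomness, private randomness and data when the mean is `θ`:
these are all independent. -/
noncomputable def law (P : Protocol m n d) (σ : ℝ≥0) (θ : Fin d → ℝ) : Measure P.Outcome :=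
  P.pubLaw.prod ((Measure.pi P.privLaw).prod (dataLaw m n σ θ))

/-- The content of the blackboard after `k` steps; it no longer changes once the protocol has
ended. -/
def board (P : Protocol m n d) (ω : P.Outcome) : ℕ → List Bool
  | 0 => []
  | k + 1 =>
    let w := P.board ω k
    if P.halt ω.1 w then w
    else
      let j := P.speaker ω.1 w
      w ++ [P.bit j ω.1 (ω.2.1 j) (ω.2.2 j) w]

open Classical in
/-- The transcript `Y`: the content of the blackboard when the protocol ends. (It is set to the
empty string on runs that never end; these runs have infinite length.) -/
noncomputable def transcript (P : Protocol m n d) (ω : P.Outcome) : List Bool :=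
  if h : ∃ k, P.halt ω.1 (P.board ω k) = true then P.board ω (Nat.find h) else []

/-- The number `|Y|` of bits written in the run: the length of the transcript, and `∞` if the run
never ends. -/
noncomputable def numBits (P : Protocol m n d) (ω : P.Outcome) : ℝ≥0∞ :=
  ⨆ k, ((P.board ω k).length : ℝ≥0∞)

/-- The communication cost: the supremum over `θ ∈ [-1,1]^d` of the expected number of bits. -/
noncomputable def commCost (P : Protocol m n d) (σ : ℝ≥0) : ℝ≥0∞ :=
  ⨆ θ ∈ Set.Icc (-1 : Fin d → ℝ) 1, ∫⁻ ω, P.numBits ω ∂(P.law σ θ)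

/-- The mean-squared loss of the protocol with an estimator that sees the transcript: the supremum
over `θ ∈ [-1,1]^d` of the expected squared Euclidean distance of estimate and mean. -/
noncomputable def loss (P : Protocol m n d) (est : List Bool → Fin d → ℝ) (σ : ℝ≥0) : ℝ≥0∞ :=
  ⨆ θ ∈ Set.Icc (-1 : Fin d → ℝ) 1,
    ∫⁻ ω, ENNReal.ofReal (∑ i, (est (P.transcript ω) i - θ i) ^ 2) ∂(P.law σ θ)

end Protocol

end DistributedMean

/-! Let V = n/σ², let S_i be the score of the whole data in direction i, and let B be the
communication cost.

The first ingredient is that each bit buys only a bounded amount, of order V, of Fisher information.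
Fix all randomness. The inputs leading to a given transcript form a product set ∏ A_j, so given the
transcript the machines stay independent. If M_ij is the conditional mean of machine j's score, then
(∑_j M_ij)² is ∑_j M_ij² plus the conditional mean of the cross terms, and the cross terms average
to zero over all transcripts, since the scores are centred and independent. Subgaussianity gives ∑_i
M_ij² ≤ 2V log(1/P(A_j)) (`SubGaussian.sum_sq_condMean_le`). Summing over j and averaging leaves 2V
times the entropy of the transcript, which is at most log 2 times its expected length. The proof
uses a linearised form, S²/(2a) ≥ vS − av²/2 with v the signed estimate, so that no sum over
transcripts is needed: `leafScore` is integrated over rectangles, by induction along the protocol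
tree (`setIntegral_runScore_le`).

The second ingredient is a Bayesian bound. The coordinates of θ are independent, each ±h with total
weight 1 − ε and uniform on [-h, h] with weight ε. The derivative of E_θ[est_i] in θ_i is E_θ[est_i
S_i], so the correlation of θ_i with the estimate is at most 2h²/ε times the prior mean of
|E_θ[est_i S_i]| (`integral_id_mul_le`). The uniform part lets the prior see the derivative on the
whole interval; the atoms keep the variance near h², the largest possible on [-h, h].

Together these give R ≥ d(1 − ε)h² − 8h⁴ε⁻²VB for every 0 < h ≤ 1 (`Protocol.loss_lower_bound`);
unbounded estimators and long runs are handled by truncation. Claim 1 takes ε = 1/2 and optimises h;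
Claim 2 takes h² = σ²/(κmn). No logarithm arises: log m ≥ 1/2 only changes the constants. -/

namespace DistributedMean

/-! ### Deterministic protocols and the quantity integrated along their runs. -/

section Run

variable {ι α : Type*} [Fintype ι] {m : ℕ}

/-- The cross terms `∑ i, ∑ j ≠ l, s i (x j) * s i (x l)`. -/
noncomputable def crossTerms (s : ι → α → ℝ) (x : Fin m → α) : ℝ :=
  ∑ i, ((∑ j, s i (x j)) ^ 2 - ∑ j, s i (x j) ^ 2)

/-- The integrand of the information inequality for the transcript being constantly `v`. -/
noncomputable def leafScore (s : ι → α → ℝ) (a : ℝ) (v : ι → ℝ) (x : Fin m → α) : ℝ :=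
  ∑ i, v i * ∑ j, s i (x j) - a / 2 * ∑ i, v i ^ 2 - crossTerms s x / (2 * a)

variable (halt : List Bool → Bool) (speaker : List Bool → Fin m)
  (bit : Fin m → α → List Bool → Bool)

/-- The blackboard after at most `k` further steps of a deterministic protocol, from content `w`. -/
def run : ℕ → List Bool → (Fin m → α) → List Bool
  | 0, w, _ => w
  | k + 1, w, x =>
    if halt w then w else run k (w ++ [bit (speaker w) (x (speaker w)) w]) x

/-- The integrand of the information inequality along a run. -/
noncomputable def runScore (s : ι → α → ℝ) (a c : ℝ) (ψ : List Bool → ι → ℝ) (k : ℕ)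
    (w : List Bool) (x : Fin m → α) : ℝ :=
  leafScore s a (ψ (run halt speaker bit k w x)) x
    - c * (((run halt speaker bit k w x).length : ℝ) - w.length)

variable {halt speaker bit}

theorem runScore_succ (s : ι → α → ℝ) (a c : ℝ) (ψ : List Bool → ι → ℝ) (k : ℕ)
    {w : List Bool} (hw : halt w = false) (b : Bool) {x : Fin m → α}
    (hb : bit (speaker w) (x (speaker w)) w = b) :
    runScore halt speaker bit s a c ψ (k + 1) w x
      = runScore halt speaker bit s a c ψ k (w ++ [b]) x - c := by
  simp only [runScore, run, hw, hb, Bool.false_eq_true, if_false, List.length_append,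
    List.length_singleton]
  push_cast
  ring

theorem runScore_of_halt (s : ι → α → ℝ) (a c : ℝ) (ψ : List Bool → ι → ℝ) (k : ℕ)
    {w : List Bool} (hw : halt w = true) :
    runScore halt speaker bit s a c ψ k w = leafScore s a (ψ w) := by
  ext x
  cases k <;> simp [runScore, run, hw]

end Run

/-! ### Information against bits, by induction over rectangles. -/

section Tree

variable {ι α : Type*} [Fintype ι] [MeasurableSpace α]

/-- A measure whose statistics `s` have a moment generating function dominated by that of
a centred Gaussian vector with covariance `V • 1`. -/
structure SubGaussian (s : ι → α → ℝ) (V : ℝ) (μ : Measure α) : Prop where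
  memLp : ∀ i, MemLp (s i) 2 μ
  integrable_exp : ∀ u : ι → ℝ, Integrable (fun x => Real.exp (∑ i, u i * s i x)) μ
  integral_exp_le : ∀ u : ι → ℝ,
    ∫ x, Real.exp (∑ i, u i * s i x) ∂μ ≤ Real.exp (V * (∑ i, u i ^ 2) / 2)

/-- An event of probability q can shift the mean of a subgaussian vector only by order √(V
log(1/q)). Jensen gives exp(u·M) ≤ E[exp(u·s) | A] ≤ q⁻¹ exp(V|u|²/2), and u is then optimised. The
bound concerns the whole vector, with no dependence on its dimension. -/
theorem SubGaussian.sum_sq_condMean_le {s : ι → α → ℝ} {V : ℝ} {μ : Measure α}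
    [IsProbabilityMeasure μ] (hs : SubGaussian s V μ) (hV : 0 < V) {A : Set α}
    (hA0 : μ A ≠ 0) :
    ∑ i, (∫ x, s i x ∂μ[|A]) ^ 2 ≤ -(2 * V * Real.log (μ.real A)) := by
  have hprob : IsProbabilityMeasure μ[|A] := cond_isProbabilityMeasure hA0
  set M : ι → ℝ := fun i => ∫ x, s i x ∂μ[|A] with hM
  have hle : μ[|A] ≤ (μ A)⁻¹ • μ := by
    rw [ProbabilityTheory.cond]
    gcongr
    exact Measure.restrict_le_self
  have hfin : (μ A)⁻¹ ≠ ∞ := ENNReal.inv_ne_top.2 hA0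
  have hint : ∀ f : α → ℝ, Integrable f μ → Integrable f μ[|A] := fun f hf =>
    (hf.smul_measure hfin).mono_measure hle
  have hq : 0 < μ.real A := by
    rw [measureReal_def]; exact ENNReal.toReal_pos hA0 (measure_ne_top _ _)
  have hsi : ∀ i, Integrable (s i) μ[|A] := fun i => hint _ ((hs.memLp i).integrable one_le_two)
  -- The maximiser of u·M − V|u|²/2.
  set u : ι → ℝ := fun i => M i / V with hu
  have hsum : Integrable (fun x => ∑ i, u i * s i x) μ[|A] :=
    integrable_finsetSum _ fun i _ => (hsi i).const_mul _
  have h1 : Real.exp (∑ i, u i * M i) ≤ ∫ x, Real.exp (∑ i, u i * s i x) ∂μ[|A] := by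
    have := convexOn_exp.map_integral_le (μ := μ[|A]) (f := fun x => ∑ i, u i * s i x)
      Real.continuous_exp.continuousOn isClosed_univ (by simp) hsum (hint _ (hs.integrable_exp u))
    rwa [integral_finsetSum _ fun i _ => (hsi i).const_mul _,
      Finset.sum_congr rfl fun i _ => integral_const_mul _ _] at this
  have h2 : ∫ x, Real.exp (∑ i, u i * s i x) ∂μ[|A]
      ≤ (μ.real A)⁻¹ * Real.exp (V * (∑ i, u i ^ 2) / 2) := by
    calc ∫ x, Real.exp (∑ i, u i * s i x) ∂μ[|A]
        ≤ ∫ x, Real.exp (∑ i, u i * s i x) ∂((μ A)⁻¹ • μ) :=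
          integral_mono_measure hle (Filter.Eventually.of_forall fun x => (Real.exp_pos _).le)
            ((hs.integrable_exp u).smul_measure hfin)
      _ = (μ.real A)⁻¹ * ∫ x, Real.exp (∑ i, u i * s i x) ∂μ := by
          rw [integral_smul_measure, ENNReal.toReal_inv, smul_eq_mul, measureReal_def]
      _ ≤ _ := by gcongr; exact hs.integral_exp_le u
  have h3 := Real.log_le_log (Real.exp_pos _) (h1.trans h2)
  rw [Real.log_exp, Real.log_mul (inv_pos.2 hq).ne' (Real.exp_pos _).ne', Real.log_exp,
    Real.log_inv] at h3
  have e1 : ∑ i, u i * M i = (∑ i, M i ^ 2) / V := by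
    rw [Finset.sum_div]; exact Finset.sum_congr rfl fun i _ => by simp only [hu]; ring
  have e2 : ∑ i, u i ^ 2 = (∑ i, M i ^ 2) / V ^ 2 := by
    rw [Finset.sum_div]; exact Finset.sum_congr rfl fun i _ => by simp only [hu]; ring
  rw [e1, e2] at h3
  have h4 : V * ((∑ i, M i ^ 2) / V ^ 2) / 2 = (∑ i, M i ^ 2) / V / 2 := by field_simp
  rw [h4] at h3
  have h5 : (∑ i, M i ^ 2) / V ≤ -(2 * Real.log (μ.real A)) := by linarith
  rw [div_le_iff₀ hV] at h5
  linarith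

theorem pi_cond {κ : Type*} [Fintype κ] (μ : κ → Measure α) [∀ j, IsProbabilityMeasure (μ j)]
    {A : κ → Set α} (hA : ∀ j, MeasurableSet (A j)) (hA0 : ∀ j, μ j (A j) ≠ 0) :
    Measure.pi (fun j => (μ j)[|A j]) = (Measure.pi μ)[|Set.univ.pi A] := by
  have : ∀ j, IsProbabilityMeasure (μ j)[|A j] := fun j => cond_isProbabilityMeasure (hA0 j)
  refine Measure.pi_eq fun t ht => ?_
  rw [cond_apply (MeasurableSet.univ_pi hA), ← Set.pi_inter_distrib, Measure.pi_pi, Measure.pi_pi,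
    ENNReal.prod_inv_distrib (fun i _ j _ _ => Or.inl (hA0 i)), ← Finset.prod_mul_distrib]
  exact Finset.prod_congr rfl fun j _ => (cond_apply (hA j) _ _).symm

variable {m : ℕ}

theorem memLp_sum_comp_eval {ν : Fin m → Measure α} [∀ j, IsProbabilityMeasure (ν j)]
    {f : α → ℝ} (hf : ∀ j, MemLp f 2 (ν j)) :
    MemLp (fun x : Fin m → α => ∑ j, f (x j)) 2 (Measure.pi ν) :=
  memLp_finsetSum _ fun j _ => (hf j).comp_measurePreserving (measurePreserving_eval ν j)

theorem integrable_crossTerm {ν : Fin m → Measure α} [∀ j, IsProbabilityMeasure (ν j)]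
    {f : α → ℝ} (hf : ∀ j, MemLp f 2 (ν j)) :
    Integrable (fun x : Fin m → α => (∑ j, f (x j)) ^ 2 - ∑ j, f (x j) ^ 2) (Measure.pi ν) :=
  (memLp_sum_comp_eval hf).integrable_sq.sub <| integrable_finsetSum _ fun j _ =>
    ((hf j).comp_measurePreserving (measurePreserving_eval ν j)).integrable_sq

/-- Additivity of the variance under a product measure: second moments cancel and only products of
means survive. -/
theorem integral_crossTerm {ν : Fin m → Measure α} [∀ j, IsProbabilityMeasure (ν j)]
    {f : α → ℝ} (hf : ∀ j, MemLp f 2 (ν j)) :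
    ∫ x : Fin m → α, ((∑ j, f (x j)) ^ 2 - ∑ j, f (x j) ^ 2) ∂(Measure.pi ν)
      = (∑ j, ∫ x, f x ∂ν j) ^ 2 - ∑ j, (∫ x, f x ∂ν j) ^ 2 := by
  have h1 := variance_sum_pi (μ := ν) (X := fun _ => f) hf
  have h2 := variance_eq_sub (memLp_sum_comp_eval hf)
  have h3 : ∀ j, MemLp (fun x : Fin m → α => f (x j)) 2 (Measure.pi ν) := fun j =>
    (hf j).comp_measurePreserving (measurePreserving_eval ν j)
  have h4 : ∫ x : Fin m → α, ∑ j, f (x j) ∂(Measure.pi ν) = ∑ j, ∫ x, f x ∂ν j := by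
    rw [integral_finsetSum _ fun j _ => (h3 j).integrable one_le_two]
    exact Finset.sum_congr rfl fun j _ => integral_comp_eval (hf j).aestronglyMeasurable
  have h5 : ∫ x : Fin m → α, ∑ j, f (x j) ^ 2 ∂(Measure.pi ν) = ∑ j, ∫ x, f x ^ 2 ∂ν j := by
    rw [integral_finsetSum _ fun j _ => (h3 j).integrable_sq]
    exact Finset.sum_congr rfl fun j _ =>
      integral_comp_eval (μ := ν) (i := j) (f := fun y => f y ^ 2)
        ((hf j).aestronglyMeasurable.pow 2)
  rw [integral_sub (memLp_sum_comp_eval hf).integrable_sq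
    (integrable_finsetSum _ fun j _ => (h3 j).integrable_sq), h5]
  have h6 : ∀ j, Var[f; ν j] = ∫ x, f x ^ 2 ∂ν j - (∫ x, f x ∂ν j) ^ 2 := fun j =>
    variance_eq_sub (hf j)
  have e : (∑ j, fun x : Fin m → α => f (x j)) = fun x => ∑ j, f (x j) := by
    ext x; simp
  rw [e, h2, Finset.sum_congr rfl fun j _ => h6 j, Finset.sum_sub_distrib, h4] at h1
  simp only [Pi.pow_apply] at h1
  linarith

theorem integrable_leafScore {s : ι → α → ℝ} {ν : Fin m → Measure α}
    [∀ j, IsProbabilityMeasure (ν j)] (hs : ∀ i j, MemLp (s i) 2 (ν j)) (a : ℝ) (v : ι → ℝ) :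
    Integrable (leafScore s a v : (Fin m → α) → ℝ) (Measure.pi ν) := by
  refine ((integrable_finsetSum _ fun i _ => ?_).sub (integrable_const _)).sub ?_
  · exact ((memLp_sum_comp_eval (hs i)).integrable one_le_two).const_mul _
  · exact (integrable_finsetSum _ fun i _ => integrable_crossTerm (hs i)).div_const _

theorem integral_leafScore {s : ι → α → ℝ} {ν : Fin m → Measure α}
    [∀ j, IsProbabilityMeasure (ν j)] (hs : ∀ i j, MemLp (s i) 2 (ν j)) (a : ℝ) (v : ι → ℝ) :
    ∫ x : Fin m → α, leafScore s a v x ∂(Measure.pi ν) =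
      ∑ i, v i * ∑ j, ∫ x, s i x ∂ν j - a / 2 * ∑ i, v i ^ 2 -
        (∑ i, ((∑ j, ∫ x, s i x ∂ν j) ^ 2 - ∑ j, (∫ x, s i x ∂ν j) ^ 2)) / (2 * a) := by
  have h1 : ∀ i, Integrable (fun x : Fin m → α => v i * ∑ j, s i (x j)) (Measure.pi ν) := fun i =>
    ((memLp_sum_comp_eval (hs i)).integrable one_le_two).const_mul _
  simp only [leafScore, crossTerms]
  have h2 : Integrable (fun x : Fin m → α => ∑ i, v i * ∑ j, s i (x j) - a / 2 * ∑ i, v i ^ 2)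
      (Measure.pi ν) := (integrable_finsetSum _ fun i _ => h1 i).sub (integrable_const _)
  rw [integral_sub h2 ((integrable_finsetSum _ fun i _ => integrable_crossTerm (hs i)).div_const _),
    integral_sub (integrable_finsetSum _ fun i _ => h1 i) (integrable_const _),
    integral_div, integral_finsetSum _ fun i _ => h1 i,
    integral_finsetSum _ fun i _ => integrable_crossTerm (hs i),
    Finset.sum_congr rfl fun i _ => integral_crossTerm (hs i)]
  simp only [integral_const_mul, integral_const, probReal_univ, one_smul]
  congr 2
  refine Finset.sum_congr rfl fun i _ => ?_
  rw [integral_finsetSum _ fun j _ => integrable_comp_eval ((hs i j).integrable one_le_two)]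
  congr 1
  exact Finset.sum_congr rfl fun j _ => integral_comp_eval (hs i j).aestronglyMeasurable

/-- On a rectangle the conditioned law is again a product, so subtracting the cross terms leaves
only ∑ M_ij²/(2a) after completing the square. The bounds −2V log μ_j(A_j) add up to −2V log p
because p is the product of the μ_j(A_j). -/
theorem setIntegral_leafScore_le {s : ι → α → ℝ} {V : ℝ} (hV : 0 < V) {μ : Fin m → Measure α}
    [∀ j, IsProbabilityMeasure (μ j)] (hs : ∀ j, SubGaussian s V (μ j)) {a : ℝ} (ha : 0 < a)
    (v : ι → ℝ) {A : Fin m → Set α} (hA : ∀ j, MeasurableSet (A j)) :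
    ∫ x in Set.univ.pi A, leafScore s a v x ∂(Measure.pi μ)
      ≤ V / a * Real.negMulLog ((Measure.pi μ).real (Set.univ.pi A)) := by
  by_cases h0 : Measure.pi μ (Set.univ.pi A) = 0
  · simp [Measure.restrict_eq_zero.2 h0, measureReal_def, h0]
  have hA0 : ∀ j, μ j (A j) ≠ 0 := by
    rw [Measure.pi_pi, ← ne_eq, Finset.prod_ne_zero_iff] at h0
    exact fun j => h0 j (Finset.mem_univ j)
  have hprob : ∀ j, IsProbabilityMeasure (μ j)[|A j] := fun j => cond_isProbabilityMeasure (hA0 j)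
  set p := (Measure.pi μ).real (Set.univ.pi A) with hp
  have hppos : 0 < p := ENNReal.toReal_pos h0 (measure_ne_top _ _)
  have hint : ∫ x in Set.univ.pi A, leafScore s a v x ∂(Measure.pi μ)
      = p * ∫ x, leafScore s a v x ∂(Measure.pi fun j => (μ j)[|A j]) := by
    rw [pi_cond μ hA hA0, ProbabilityTheory.cond, integral_smul_measure, ENNReal.toReal_inv,
      ← measureReal_def, ← hp, smul_eq_mul, mul_inv_cancel_left₀ hppos.ne']
  have hmem : ∀ i j, MemLp (s i) 2 (μ j)[|A j] := fun i j =>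
    (((hs j).memLp i).restrict _).smul_measure (ENNReal.inv_ne_top.2 (hA0 j))
  have hlog : Real.log p = ∑ j, Real.log ((μ j).real (A j)) := by
    rw [hp, measureReal_def, Measure.pi_pi, ENNReal.toReal_prod, Real.log_prod]
    · rfl
    · exact fun j _ => (ENNReal.toReal_pos (hA0 j) (measure_ne_top _ _)).ne'
  rw [hint, integral_leafScore hmem, Real.negMulLog, hlog]
  set M : ι → Fin m → ℝ := fun i j => ∫ x, s i x ∂(μ j)[|A j] with hM
  have h1 : ∑ i, ∑ j, M i j ^ 2 ≤ -(2 * V * ∑ j, Real.log ((μ j).real (A j))) := by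
    rw [Finset.sum_comm, Finset.mul_sum, ← Finset.sum_neg_distrib]
    exact Finset.sum_le_sum fun j _ => (hs j).sum_sq_condMean_le hV (hA0 j)
  have h2 : ∑ i, v i * ∑ j, M i j ≤ a / 2 * ∑ i, v i ^ 2 + (∑ i, (∑ j, M i j) ^ 2) / (2 * a) := by
    rw [Finset.mul_sum, Finset.sum_div, ← Finset.sum_add_distrib]
    refine Finset.sum_le_sum fun i _ => ?_
    have : a / 2 * v i ^ 2 + (∑ j, M i j) ^ 2 / (2 * a) - v i * ∑ j, M i j
        = (a * v i - ∑ j, M i j) ^ 2 / (2 * a) := by field_simp; ring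
    have : 0 ≤ (a * v i - ∑ j, M i j) ^ 2 / (2 * a) := by positivity
    linarith
  have h3 : (∑ i, ∑ j, M i j ^ 2) / (2 * a) ≤ -(V / a * ∑ j, Real.log ((μ j).real (A j))) := by
    rw [div_le_iff₀ (by positivity)]
    refine h1.trans (le_of_eq ?_)
    field_simp
  rw [Finset.sum_sub_distrib, sub_div]
  calc p * _ ≤ p * -(V / a * ∑ j, Real.log ((μ j).real (A j))) := by
        gcongr; linarith
    _ = _ := by ring

/-- Concavity at the midpoint: splitting a cell in two raises the entropy by at most log 2 times its
mass, which is the price of one bit. -/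
theorem negMulLog_add_negMulLog_le {x y : ℝ} (hx : 0 ≤ x) (hy : 0 ≤ y) :
    Real.negMulLog x + Real.negMulLog y ≤ Real.negMulLog (x + y) + (x + y) * Real.log 2 := by
  have h := Real.concaveOn_negMulLog.2 hx hy (by norm_num : (0 : ℝ) ≤ 1 / 2)
    (by norm_num : (0 : ℝ) ≤ 1 / 2) (by norm_num)
  simp only [smul_eq_mul, ← mul_add] at h
  rw [Real.negMulLog_mul] at h
  have : Real.negMulLog (1 / 2) = Real.log 2 / 2 := by
    rw [Real.negMulLog, one_div, Real.log_inv]; ring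
  rw [this] at h
  linarith

variable {halt : List Bool → Bool} {speaker : List Bool → Fin m}
  {bit : Fin m → α → List Bool → Bool}

theorem integrable_runScore {s : ι → α → ℝ} {μ : Fin m → Measure α}
    [∀ j, IsProbabilityMeasure (μ j)] (hs : ∀ i j, MemLp (s i) 2 (μ j))
    (hbit : ∀ j w, Measurable fun y => bit j y w) (a c : ℝ) (ψ : List Bool → ι → ℝ) (k : ℕ)
    (w : List Bool) :
    Integrable (runScore halt speaker bit s a c ψ k w) (Measure.pi μ) := by
  induction k generalizing w with
  | zero =>
    have : runScore halt speaker bit s a c ψ 0 w = leafScore s a (ψ w) := by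
      ext x; simp [runScore, run]
    rw [this]; exact integrable_leafScore hs a _
  | succ k ih =>
    cases hw : halt w with
    | true => rw [runScore_of_halt s a c ψ (k + 1) hw]; exact integrable_leafScore hs a _
    | false =>
      have hC : MeasurableSet {x : Fin m → α | bit (speaker w) (x (speaker w)) w = true} :=
        ((hbit (speaker w) w).comp (measurable_pi_apply (speaker w))) (measurableSet_singleton true)
      classical
      have := Integrable.piecewise hC
        ((ih (w ++ [true])).sub (integrable_const c)).integrableOn
        ((ih (w ++ [false])).sub (integrable_const c)).integrableOn
      refine this.congr (Filter.Eventually.of_forall fun x => ?_)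
      by_cases hx : x ∈ {x : Fin m → α | bit (speaker w) (x (speaker w)) w = true}
      · rw [Set.piecewise_eq_of_mem _ _ _ hx, runScore_succ s a c ψ k hw true hx]; rfl
      · rw [Set.piecewise_eq_of_notMem _ _ _ hx,
          runScore_succ s a c ψ k hw false (Bool.eq_false_of_not_eq_true hx)]; rfl

/-- The induction is over the remaining steps, for all starting contents and all rectangles. A new
bit splits the rectangle into two rectangles, and the charge per bit, V/a · log 2, pays exactly for
the growth of the entropy term. -/
theorem setIntegral_runScore_le {s : ι → α → ℝ} {V : ℝ} (hV : 0 < V) {μ : Fin m → Measure α}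
    [∀ j, IsProbabilityMeasure (μ j)] (hs : ∀ j, SubGaussian s V (μ j)) {a : ℝ} (ha : 0 < a)
    (hbit : ∀ j w, Measurable fun y => bit j y w) (ψ : List Bool → ι → ℝ) (k : ℕ)
    (w : List Bool) {A : Fin m → Set α} (hA : ∀ j, MeasurableSet (A j)) :
    ∫ x in Set.univ.pi A, runScore halt speaker bit s a (V / a * Real.log 2) ψ k w x
        ∂(Measure.pi μ)
      ≤ V / a * Real.negMulLog ((Measure.pi μ).real (Set.univ.pi A)) := by
  induction k generalizing w A with
  | zero =>
    have : runScore halt speaker bit s a (V / a * Real.log 2) ψ 0 w = leafScore s a (ψ w) := by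
      ext x; simp [runScore, run]
    rw [this]; exact setIntegral_leafScore_le hV hs ha _ hA
  | succ k ih =>
    cases hw : halt w with
    | true => rw [runScore_of_halt s a _ ψ (k + 1) hw]; exact setIntegral_leafScore_le hV hs ha _ hA
    | false =>
      set c := V / a * Real.log 2 with hc
      set l := speaker w with hl
      let C : Bool → Set α := fun b => {y | bit l y w = b}
      have hC : ∀ b, MeasurableSet (C b) := fun b => hbit l w (measurableSet_singleton b)
      -- The bit depends on the input of the speaker alone, so only that factor is cut and both
      -- pieces are rectangles.
      let A' : Bool → Fin m → Set α := fun b j => if j = l then A j ∩ C b else A j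
      have hA' : ∀ b j, MeasurableSet (A' b j) := by
        intro b j
        by_cases hj : j = l
        · simp only [A', hj, if_true]; exact (hA l).inter (hC b)
        · simp only [A', hj, if_false]; exact hA j
      have hmem : ∀ b x, x ∈ Set.univ.pi (A' b) ↔ x ∈ Set.univ.pi A ∧ bit l (x l) w = b := by
        intro b x
        simp only [Set.mem_univ_pi]
        constructor
        · intro h
          have hx := h l
          simp only [A', if_true] at hx
          refine ⟨fun j => ?_, hx.2⟩
          have := h j
          by_cases hj : j = l
          · subst hj; exact hx.1
          · simpa only [A', hj, if_false] using this
        · rintro ⟨h, hb⟩ j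
          by_cases hj : j = l
          · subst hj; simp only [A', if_true]; exact ⟨h _, hb⟩
          · simp only [A', hj, if_false]; exact h j
      have hunion : Set.univ.pi A = Set.univ.pi (A' true) ∪ Set.univ.pi (A' false) := by
        ext x
        simp only [Set.mem_union, hmem]
        cases bit l (x l) w <;> simp
      have hdisj : Disjoint (Set.univ.pi (A' true)) (Set.univ.pi (A' false)) := by
        rw [Set.disjoint_left]
        intro x h1 h2
        rw [hmem] at h1 h2
        exact Bool.noConfusion (h1.2.symm.trans h2.2)
      have hint := fun k w => integrable_runScore (halt := halt) (speaker := speaker) (μ := μ)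
        (fun i j => (hs j).memLp i) hbit a c ψ k w
      have hmeas : ∀ b, MeasurableSet (Set.univ.pi (A' b)) := fun b =>
        MeasurableSet.univ_pi (hA' b)
      have hsplit : ∀ b, ∫ x in Set.univ.pi (A' b), runScore halt speaker bit s a c ψ (k + 1) w x
            ∂(Measure.pi μ)
          ≤ V / a * Real.negMulLog ((Measure.pi μ).real (Set.univ.pi (A' b)))
            - c * (Measure.pi μ).real (Set.univ.pi (A' b)) := by
        intro b
        rw [setIntegral_congr_fun (hmeas b) fun x hx =>
          runScore_succ s a c ψ k hw b ((hmem b x).1 hx).2,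
          integral_sub (hint _ _).integrableOn (integrable_const _), setIntegral_const, smul_eq_mul,
          mul_comm c]
        exact sub_le_sub_right (ih _ (hA' b)) _
      have hreal : (Measure.pi μ).real (Set.univ.pi A)
          = (Measure.pi μ).real (Set.univ.pi (A' true))
            + (Measure.pi μ).real (Set.univ.pi (A' false)) := by
        rw [hunion, measureReal_union hdisj (hmeas false)]
      rw [hreal]
      rw [hunion, setIntegral_union hdisj (hmeas false) (hint _ _).integrableOn
        (hint _ _).integrableOn]
      have h1 := negMulLog_add_negMulLog_le
        (measureReal_nonneg (μ := Measure.pi μ) (s := Set.univ.pi (A' true)))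
        (measureReal_nonneg (μ := Measure.pi μ) (s := Set.univ.pi (A' false)))
      have h2 := mul_le_mul_of_nonneg_left h1 (by positivity : 0 ≤ V / a)
      have ht := hsplit true
      have hf := hsplit false
      simp only [hc] at ht hf ⊢
      linarith

theorem integral_runScore_nonpos {s : ι → α → ℝ} {V : ℝ} (hV : 0 < V) {μ : Fin m → Measure α}
    [∀ j, IsProbabilityMeasure (μ j)] (hs : ∀ j, SubGaussian s V (μ j)) {a : ℝ} (ha : 0 < a)
    (hbit : ∀ j w, Measurable fun y => bit j y w) (ψ : List Bool → ι → ℝ) (k : ℕ)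
    (w : List Bool) :
    ∫ x, runScore halt speaker bit s a (V / a * Real.log 2) ψ k w x ∂(Measure.pi μ) ≤ 0 := by
  have h := setIntegral_runScore_le (halt := halt) (speaker := speaker) hV hs ha hbit ψ k w
    (A := fun _ => Set.univ) fun _ => MeasurableSet.univ
  simpa [Set.pi_univ] using h

end Tree

/-! ### Gaussian densities, scores and their moments. -/

section Density

theorem pi_withDensity_ofReal {κ α : Type*} [Fintype κ] [MeasurableSpace α] (μ : κ → Measure α)
    [∀ i, SigmaFinite (μ i)] {f : κ → α → ℝ} (hf0 : ∀ i x, 0 ≤ f i x)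
    (hf : ∀ i, Integrable (f i) (μ i)) :
    Measure.pi (fun i => (μ i).withDensity fun x => ENNReal.ofReal (f i x))
      = (Measure.pi μ).withDensity fun x => ENNReal.ofReal (∏ i, f i (x i)) := by
  have : ∀ i, IsFiniteMeasure ((μ i).withDensity fun x => ENNReal.ofReal (f i x)) := fun i =>
    isFiniteMeasure_withDensity_ofReal (hf i).2
  refine Measure.pi_eq fun t ht => ?_
  have hint : ∀ i, Integrable (f i) ((μ i).restrict (t i)) := fun i => (hf i).restrict
  rw [withDensity_apply _ (MeasurableSet.univ_pi ht), Measure.restrict_pi_pi,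
    ← ofReal_integral_eq_lintegral_ofReal (Integrable.fintype_prod hint)
      (Filter.Eventually.of_forall fun x => Finset.prod_nonneg fun i _ => hf0 i _),
    integral_fintype_prod_eq_prod, ENNReal.ofReal_prod_of_nonneg
      fun i _ => integral_nonneg (hf0 i)]
  refine Finset.prod_congr rfl fun i _ => ?_
  rw [withDensity_apply _ (ht i), ofReal_integral_eq_lintegral_ofReal (hint i)
    (Filter.Eventually.of_forall (hf0 i))]

theorem hasDerivAt_prod_of_logDeriv {κ : Type*} (S : Finset κ) {f : κ → ℝ → ℝ} {s : κ → ℝ} {t : ℝ}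
    (hf : ∀ i ∈ S, HasDerivAt (f i) (f i t * s i) t) :
    HasDerivAt (fun t => ∏ i ∈ S, f i t) ((∏ i ∈ S, f i t) * ∑ i ∈ S, s i) t := by
  classical
  induction S using Finset.induction_on with
  | empty => simpa using hasDerivAt_const t (1 : ℝ)
  | insert i S hi ih =>
    simp only [Finset.prod_insert hi, Finset.sum_insert hi]
    refine ((hf i (Finset.mem_insert_self i S)).mul
      (ih fun j hj => hf j (Finset.mem_insert_of_mem hj))).congr_deriv ?_
    ring

theorem hasDerivAt_gaussianPDFReal {ψ : ℝ → ℝ} {c t : ℝ} (hψ : HasDerivAt ψ c t) (v : ℝ≥0) (x : ℝ) :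
    HasDerivAt (fun t => gaussianPDFReal (ψ t) v x)
      (gaussianPDFReal (ψ t) v x * (c * ((x - ψ t) / v))) t := by
  simp only [gaussianPDFReal]
  have h := ((((hψ.const_sub x).pow 2).neg.div_const (2 * (v : ℝ))).exp).const_mul
    ((√(2 * Real.pi * v))⁻¹)
  refine h.congr_deriv ?_
  simp only [Pi.neg_apply, Pi.pow_apply]
  by_cases hv : (v : ℝ) = 0
  · simp [hv]
  · field_simp
    push_cast
    ring

end Density

variable {m n d : ℕ}

/-- The score (derivative of the log-likelihood) in direction `i` of the samples of one machine. -/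
noncomputable def machineScore (σ : ℝ≥0) (θ : Fin d → ℝ) (i : Fin d) (y : Samples n d) : ℝ :=
  ∑ k, (y k i - θ i) / (σ : ℝ) ^ 2

/-- The score in direction `i` of the whole data. -/
noncomputable def dataScore (σ : ℝ≥0) (θ : Fin d → ℝ) (i : Fin d) (x : Fin m → Samples n d) : ℝ :=
  ∑ j, machineScore σ θ i (x j)

/-- The density of the data with respect to Lebesgue measure. -/
noncomputable def dataDensity (σ : ℝ≥0) (θ : Fin d → ℝ) (x : Fin m → Samples n d) : ℝ :=
  ∏ j, ∏ k, ∏ i, gaussianPDFReal (θ i) (σ ^ 2) (x j k i)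

instance (σ : ℝ≥0) (θ : Fin d → ℝ) : IsProbabilityMeasure (gaussianVec σ θ) := by
  unfold gaussianVec; infer_instance

instance (σ : ℝ≥0) (θ : Fin d → ℝ) : IsProbabilityMeasure (dataLaw m n σ θ) := by
  unfold dataLaw; infer_instance

theorem dataDensity_nonneg (σ : ℝ≥0) (θ : Fin d → ℝ) (x : Fin m → Samples n d) :
    0 ≤ dataDensity σ θ x :=
  Finset.prod_nonneg fun _ _ => Finset.prod_nonneg fun _ _ => Finset.prod_nonneg fun _ _ =>
    gaussianPDFReal_nonneg _ _ _

theorem integrable_gaussianVec_density (σ : ℝ≥0) (θ : Fin d → ℝ) :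
    Integrable fun y : Fin d → ℝ => ∏ i, gaussianPDFReal (θ i) (σ ^ 2) (y i) :=
  Integrable.fintype_prod fun i => integrable_gaussianPDFReal (θ i) (σ ^ 2)

theorem gaussianVec_eq_withDensity {σ : ℝ≥0} (hσ : 0 < σ) (θ : Fin d → ℝ) :
    gaussianVec σ θ
      = volume.withDensity fun y => ENNReal.ofReal (∏ i, gaussianPDFReal (θ i) (σ ^ 2) (y i)) := by
  have hv : σ ^ 2 ≠ 0 := (pow_pos hσ 2).ne'
  simp only [gaussianVec, gaussianReal_of_var_ne_zero _ hv]
  exact pi_withDensity_ofReal (fun _ => volume) (fun i => gaussianPDFReal_nonneg (θ i) (σ ^ 2))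
    fun i => integrable_gaussianPDFReal (θ i) (σ ^ 2)

theorem dataLaw_eq_withDensity {σ : ℝ≥0} (hσ : 0 < σ) (θ : Fin d → ℝ) :
    dataLaw m n σ θ = volume.withDensity fun x => ENNReal.ofReal (dataDensity σ θ x) := by
  have h0 : ∀ y : Fin d → ℝ, 0 ≤ ∏ i, gaussianPDFReal (θ i) (σ ^ 2) (y i) := fun y =>
    Finset.prod_nonneg fun i _ => gaussianPDFReal_nonneg _ _ _
  have h1 := pi_withDensity_ofReal (fun _ : Fin n => (volume : Measure (Fin d → ℝ)))
    (fun _ => h0) fun _ => integrable_gaussianVec_density σ θ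
  have h2 := pi_withDensity_ofReal (fun _ : Fin m => (volume : Measure (Samples n d)))
    (fun _ y => Finset.prod_nonneg fun k _ => h0 (y k))
    fun _ => Integrable.fintype_prod fun _ => integrable_gaussianVec_density σ θ
  simp only [dataLaw, gaussianVec_eq_withDensity hσ]
  rw [h1]
  exact h2

theorem hasDerivAt_dataDensity (σ : ℝ≥0) (θ : Fin d → ℝ) (i : Fin d) (x : Fin m → Samples n d)
    (t : ℝ) :
    HasDerivAt (fun t => dataDensity σ (Function.update θ i t) x)
      (dataDensity σ (Function.update θ i t) x * dataScore σ (Function.update θ i t) i x) t := by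
  have h := hasDerivAt_prod_of_logDeriv Finset.univ (t := t)
    (f := fun (j : Fin m) t => ∏ k, ∏ l, gaussianPDFReal (Function.update θ i t l) (σ ^ 2) (x j k l))
    fun j _ => hasDerivAt_prod_of_logDeriv Finset.univ fun k _ =>
      hasDerivAt_prod_of_logDeriv Finset.univ fun l _ =>
        hasDerivAt_gaussianPDFReal (hasDerivAt_pi.1 (hasDerivAt_update θ i t) l) (σ ^ 2) (x j k l)
  refine h.congr_deriv ?_
  rw [dataDensity, dataScore]
  congr 1
  refine Finset.sum_congr rfl fun j _ => Finset.sum_congr rfl fun k _ => ?_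
  rw [Finset.sum_eq_single i]
  · simp
  · intro l _ hl
    simp [hl]
  · simp

theorem measurable_dataDensity (σ : ℝ≥0) :
    Measurable fun p : (Fin d → ℝ) × (Fin m → Samples n d) => dataDensity σ p.1 p.2 := by
  refine Finset.measurable_prod _ fun j _ => Finset.measurable_prod _ fun k _ =>
    Finset.measurable_prod _ fun i _ => ?_
  exact measurable_uncurry_gaussianPDFReal.comp
    (f := fun p : (Fin d → ℝ) × (Fin m → Samples n d) => (p.1 i, σ ^ 2, p.2 j k i)) (by fun_prop)

theorem measurable_dataScore (σ : ℝ≥0) (i : Fin d) :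
    Measurable fun p : (Fin d → ℝ) × (Fin m → Samples n d) => dataScore σ p.1 i p.2 := by
  unfold dataScore machineScore
  fun_prop

theorem continuous_dataDensity (σ : ℝ≥0) (x : Fin m → Samples n d) :
    Continuous fun θ : Fin d → ℝ => dataDensity σ θ x := by
  unfold dataDensity
  simp only [gaussianPDFReal]
  fun_prop

theorem continuous_dataScore (σ : ℝ≥0) (i : Fin d) (x : Fin m → Samples n d) :
    Continuous fun θ : Fin d → ℝ => dataScore σ θ i x := by
  unfold dataScore machineScore
  fun_prop

theorem integral_exp_gaussianReal {v : ℝ≥0} (hv : v ≠ 0) (μ u : ℝ) :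
    ∫ x, Real.exp (u * ((x - μ) / v)) ∂(gaussianReal μ v) = Real.exp (u ^ 2 / (2 * v)) := by
  have hv' : (v : ℝ) ≠ 0 := by exact_mod_cast hv
  have h := congrFun (mgf_fun_id_gaussianReal (μ := μ) (v := v)) (u / v)
  rw [mgf] at h
  have e : ∀ x : ℝ, Real.exp (u * ((x - μ) / v))
      = Real.exp (-(u * μ / v)) * Real.exp (u / v * x) := fun x => by
    rw [← Real.exp_add]; congr 1; ring
  simp only [e]
  rw [integral_const_mul, h, ← Real.exp_add]
  congr 1
  field_simp
  ring

theorem integrable_exp_gaussianReal (v : ℝ≥0) (μ u : ℝ) :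
    Integrable (fun x => Real.exp (u * ((x - μ) / v))) (gaussianReal μ v) := by
  have e : ∀ x : ℝ, Real.exp (u * ((x - μ) / v))
      = Real.exp (-(u * μ / v)) * Real.exp (u / v * x) := fun x => by
    rw [← Real.exp_add]; congr 1; ring
  simp only [e]
  exact (integrable_exp_mul_gaussianReal _).const_mul _

theorem exp_sum_machineScore (σ : ℝ≥0) (θ u : Fin d → ℝ) (y : Samples n d) :
    Real.exp (∑ i, u i * machineScore σ θ i y)
      = ∏ k, ∏ i, Real.exp (u i * ((y k i - θ i) / ((σ ^ 2 : ℝ≥0) : ℝ))) := by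
  simp only [← Real.exp_sum, machineScore, Finset.mul_sum, NNReal.coe_pow]
  rw [Finset.sum_comm]

theorem subGaussian_machineScore {σ : ℝ≥0} (hσ : 0 < σ) (θ : Fin d → ℝ) :
    SubGaussian (machineScore σ θ) ((n : ℝ) / (σ : ℝ) ^ 2)
      (Measure.pi fun _ : Fin n => gaussianVec σ θ) where
  memLp i := by
    unfold machineScore
    refine memLp_finsetSum _ fun k _ => ?_
    have h1 : MemLp (fun x : ℝ => (x - θ i) / (σ : ℝ) ^ 2) 2 (gaussianReal (θ i) (σ ^ 2)) := by
      simp only [div_eq_inv_mul]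
      exact ((memLp_id_gaussianReal 2).sub (memLp_const _)).const_mul _
    have h2 := h1.comp_measurePreserving
      (measurePreserving_eval (fun i => gaussianReal (θ i) (σ ^ 2)) i)
    exact h2.comp_measurePreserving
      (measurePreserving_eval (fun _ : Fin n => gaussianVec σ θ) k)
  integrable_exp u := by
    simp only [exp_sum_machineScore]
    exact Integrable.fintype_prod fun k => Integrable.fintype_prod fun i =>
      integrable_exp_gaussianReal _ _ _
  integral_exp_le u := by
    simp only [exp_sum_machineScore]
    rw [integral_fintype_prod_eq_prod (𝕜 := ℝ) (fun (_ : Fin n) (y : Fin d → ℝ) =>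
      ∏ i, Real.exp (u i * ((y i - θ i) / ((σ ^ 2 : ℝ≥0) : ℝ))))]
    simp only [gaussianVec]
    rw [integral_fintype_prod_eq_prod (𝕜 := ℝ) (fun (i : Fin d) (y : ℝ) =>
      Real.exp (u i * ((y - θ i) / ((σ ^ 2 : ℝ≥0) : ℝ))))]
    simp only [integral_exp_gaussianReal (pow_pos hσ 2).ne', ← Real.exp_sum, Finset.prod_const,
      Finset.card_univ, Fintype.card_fin, ← Real.exp_nat_mul, ← Finset.sum_div]
    refine le_of_eq (congrArg Real.exp ?_)
    push_cast
    field_simp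

/-- A crude bound from |y| ≤ e^y + e^(-y). Only its uniformity in the parameter matters: it supplies
the domination needed for Fubini. -/
theorem SubGaussian.integral_abs_le {ι α : Type*} [Fintype ι] [MeasurableSpace α]
    {s : ι → α → ℝ} {V : ℝ} {μ : Measure α} [IsProbabilityMeasure μ] (hs : SubGaussian s V μ)
    (i : ι) : ∫ x, |s i x| ∂μ ≤ 2 * Real.exp (V / 2) := by
  classical
  have key : ∀ c : ℝ, c ^ 2 = 1 → Integrable (fun x => Real.exp (c * s i x)) μ ∧
      ∫ x, Real.exp (c * s i x) ∂μ ≤ Real.exp (V / 2) := by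
    intro c hc
    have h1 := hs.integrable_exp (Pi.single i c)
    have h2 := hs.integral_exp_le (Pi.single i c)
    have e1 : ∀ x, ∑ l, (Pi.single i c : ι → ℝ) l * s l x = c * s i x := fun x => by
      rw [Finset.sum_eq_single i] <;> simp +contextual
    have e2 : ∑ l, (Pi.single i c : ι → ℝ) l ^ 2 = 1 := by
      rw [Finset.sum_eq_single i] <;> simp +contextual [hc]
    simp only [e1, e2, mul_one] at h1 h2
    exact ⟨h1, h2⟩
  obtain ⟨i1, b1⟩ := key 1 (by norm_num)
  obtain ⟨i2, b2⟩ := key (-1) (by norm_num)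
  have hle : ∀ x, |s i x| ≤ Real.exp (1 * s i x) + Real.exp (-1 * s i x) := by
    intro x
    have h1 := Real.add_one_le_exp (1 * s i x)
    have h2 := Real.add_one_le_exp (-1 * s i x)
    have h3 := Real.exp_pos (1 * s i x)
    have h4 := Real.exp_pos (-1 * s i x)
    rw [abs_le]; constructor <;> linarith
  calc ∫ x, |s i x| ∂μ ≤ ∫ x, (Real.exp (1 * s i x) + Real.exp (-1 * s i x)) ∂μ :=
        integral_mono ((hs.memLp i).integrable one_le_two).abs (i1.add i2) hle
    _ ≤ _ := by rw [integral_add i1 i2]; linarith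

theorem integrable_dataScore {σ : ℝ≥0} (hσ : 0 < σ) (θ : Fin d → ℝ) (i : Fin d) :
    Integrable (dataScore σ θ i) (dataLaw m n σ θ) :=
  (memLp_sum_comp_eval fun _ => (subGaussian_machineScore hσ θ).memLp i).integrable one_le_two

theorem integral_abs_dataScore_le {σ : ℝ≥0} (hσ : 0 < σ) (θ : Fin d → ℝ) (i : Fin d) :
    ∫ x, |dataScore σ θ i x| ∂(dataLaw m n σ θ)
      ≤ m * (2 * Real.exp ((n : ℝ) / (σ : ℝ) ^ 2 / 2)) := by
  have hs := subGaussian_machineScore (n := n) hσ θ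
  have hint : ∀ j : Fin m, Integrable (fun x : Fin m → Samples n d => |machineScore σ θ i (x j)|)
      (dataLaw m n σ θ) := fun j =>
    integrable_comp_eval (μ := fun _ : Fin m => Measure.pi fun _ : Fin n => gaussianVec σ θ)
      (i := j) (f := fun y => |machineScore σ θ i y|) ((hs.memLp i).integrable one_le_two).abs
  calc ∫ x, |dataScore σ θ i x| ∂(dataLaw m n σ θ)
      ≤ ∫ x, ∑ j, |machineScore σ θ i (x j)| ∂(dataLaw m n σ θ) :=
        integral_mono (integrable_dataScore hσ θ i).abs (integrable_finsetSum _ fun j _ => hint j)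
          fun x => Finset.abs_sum_le_sum_abs _ _
    _ = ∑ j : Fin m, ∫ x, |machineScore σ θ i (x j)| ∂(dataLaw m n σ θ) :=
        integral_finsetSum _ fun j _ => hint j
    _ ≤ ∑ _j : Fin m, 2 * Real.exp ((n : ℝ) / (σ : ℝ) ^ 2 / 2) := by
        refine Finset.sum_le_sum fun j _ => ?_
        refine le_trans (le_of_eq ?_) (hs.integral_abs_le i)
        exact integral_comp_eval
          (μ := fun _ : Fin m => Measure.pi fun _ : Fin n => gaussianVec σ θ) (i := j)
          (f := fun y => |machineScore σ θ i y|) ((hs.memLp i).aestronglyMeasurable.norm)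
    _ = _ := by simp

/-- `run` peels off the first step, which suits the tree induction, while `board` appends the last
one; this reconciles the two recursions. -/
theorem run_succ_eq {α : Type*} {m : ℕ} (halt : List Bool → Bool) (speaker : List Bool → Fin m)
    (bit : Fin m → α → List Bool → Bool) (k : ℕ) (w : List Bool) (x : Fin m → α) :
    run halt speaker bit (k + 1) w x =
      if halt (run halt speaker bit k w x) then run halt speaker bit k w x
      else run halt speaker bit k w x ++ [bit (speaker (run halt speaker bit k w x))
        (x (speaker (run halt speaker bit k w x))) (run halt speaker bit k w x)] := by
  induction k generalizing w with
  | zero => rfl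
  | succ k ih =>
    rw [run]
    by_cases hw : halt w = true
    · simp [run, hw]
    · rw [if_neg hw, ih]
      simp only [run, hw]
      rfl

/-! ### From deterministic runs to randomised protocols, with truncation after `k` steps. -/

namespace Protocol

variable {m n d : ℕ} (P : Protocol m n d)

instance (σ : ℝ≥0) (θ : Fin d → ℝ) : IsProbabilityMeasure (P.law σ θ) := by
  unfold law; infer_instance

theorem board_succ (ω : P.Outcome) (k : ℕ) :
    P.board ω (k + 1) = if P.halt ω.1 (P.board ω k) then P.board ω k
      else P.board ω k ++ [P.bit (P.speaker ω.1 (P.board ω k)) ω.1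
        (ω.2.1 (P.speaker ω.1 (P.board ω k))) (ω.2.2 (P.speaker ω.1 (P.board ω k)))
        (P.board ω k)] := rfl

theorem board_eq_run (ω : P.Outcome) (k : ℕ) :
    P.board ω k = run (P.halt ω.1) (P.speaker ω.1)
      (fun j y w => P.bit j ω.1 (ω.2.1 j) y w) k [] ω.2.2 := by
  induction k with
  | zero => rfl
  | succ k ih => rw [run_succ_eq, board_succ, ih]

theorem length_board_le (ω : P.Outcome) (k : ℕ) : (P.board ω k).length ≤ k := by
  induction k with
  | zero => exact le_rfl
  | succ k ih =>
    rw [board_succ]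
    split_ifs
    · omega
    · rw [List.length_append, List.length_singleton]; omega

theorem length_board_of_not_halt {ω : P.Outcome} {k : ℕ}
    (h : P.halt ω.1 (P.board ω k) = false) : (P.board ω k).length = k := by
  induction k with
  | zero => rfl
  | succ k ih =>
    by_cases hk : P.halt ω.1 (P.board ω k) = true
    · rw [board_succ, if_pos hk, hk] at h
      exact Bool.noConfusion h
    · rw [board_succ, if_neg hk, List.length_append, List.length_singleton,
        ih (Bool.eq_false_of_not_eq_true hk)]

theorem board_eq_of_halt {ω : P.Outcome} {k l : ℕ} (hkl : k ≤ l)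
    (h : P.halt ω.1 (P.board ω k) = true) : P.board ω l = P.board ω k := by
  induction l, hkl using Nat.le_induction with
  | base => rfl
  | succ l _ ih => rw [board_succ, ih, if_pos h]

theorem transcript_eq_board {ω : P.Outcome} {k : ℕ}
    (h : P.halt ω.1 (P.board ω k) = true) : P.transcript ω = P.board ω k := by
  have hex : ∃ k, P.halt ω.1 (P.board ω k) = true := ⟨k, h⟩
  rw [transcript, dif_pos hex]
  exact (P.board_eq_of_halt (Nat.find_min' hex h) (Nat.find_spec hex)).symm

/-- There are only countably many bit strings, so it suffices to check one step for each fixed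
content. -/
theorem measurable_board (k : ℕ) : Measurable[_, ⊤] fun ω : P.Outcome => P.board ω k := by
  let : MeasurableSpace (List Bool) := ⊤
  induction k with
  | zero => exact measurable_const
  | succ k ih =>
    let step : P.Outcome × List Bool → List Bool := fun p =>
      if P.halt p.1.1 p.2 then p.2
      else p.2 ++ [P.bit (P.speaker p.1.1 p.2) p.1.1 (p.1.2.1 (P.speaker p.1.1 p.2))
        (p.1.2.2 (P.speaker p.1.1 p.2)) p.2]
    have hstep : Measurable step := by
      refine measurable_from_prod_countable_left fun w => ?_
      refine Measurable.ite (((P.measurable_halt w).comp measurable_fst)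
        (measurableSet_singleton true)) measurable_const ?_
      have hbit : Measurable fun ω : P.Outcome => P.bit (P.speaker ω.1 w) ω.1
          (ω.2.1 (P.speaker ω.1 w)) (ω.2.2 (P.speaker ω.1 w)) w := by
        have h1 : Measurable fun p : P.Outcome × Fin m =>
            P.bit p.2 p.1.1 (p.1.2.1 p.2) (p.1.2.2 p.2) w := by
          refine measurable_from_prod_countable_left fun j => ?_
          exact (P.measurable_bit j w).comp (f := fun ω : P.Outcome => (ω.1, ω.2.1 j, ω.2.2 j))
            (by fun_prop)
        exact h1.comp (measurable_id.prodMk ((P.measurable_speaker w).comp measurable_fst))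
      exact (measurable_from_top (f := fun b : Bool => w ++ [b])).comp hbit
    exact hstep.comp (measurable_id.prodMk ih)

theorem measurable_length_board (k : ℕ) :
    Measurable fun ω : P.Outcome => (P.board ω k).length :=
  (@measurable_from_top _ _ _ List.length).comp (P.measurable_board k)

/-- The estimate after `k` steps: the given estimator if the protocol has ended, and `0` if not. -/
noncomputable def truncEst (est : List Bool → Fin d → ℝ) (k : ℕ) (i : Fin d) (ω : P.Outcome) : ℝ :=
  if P.halt ω.1 (P.board ω k) then est (P.board ω k) i else 0

theorem measurable_truncEst (est : List Bool → Fin d → ℝ) (k : ℕ) (i : Fin d) :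
    Measurable (P.truncEst est k i) := by
  let : MeasurableSpace (List Bool) := ⊤
  let f : P.Outcome × List Bool → ℝ := fun p => if P.halt p.1.1 p.2 then est p.2 i else 0
  have hf : Measurable f := by
    refine measurable_from_prod_countable_left fun w => ?_
    change Measurable fun ω : P.Outcome => if P.halt ω.1 w then est w i else 0
    exact Measurable.ite (((P.measurable_halt w).comp measurable_fst)
      (measurableSet_singleton true)) measurable_const measurable_const
  exact hf.comp (measurable_id.prodMk (P.measurable_board k))

/-- Only finitely many boards have length at most `k`; this boundedness is why the estimator is
truncated. -/
theorem exists_abs_truncEst_le (est : List Bool → Fin d → ℝ) (k : ℕ) :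
    ∃ M : ℝ, ∀ i ω, |P.truncEst est k i ω| ≤ M := by
  have hfin : ({w : List Bool | w.length ≤ k} ×ˢ (Set.univ : Set (Fin d))).Finite :=
    (List.finite_length_le Bool k).prod Set.finite_univ
  obtain ⟨M, hM⟩ := (hfin.image fun p => |est p.1 p.2|).bddAbove
  refine ⟨max M 0, fun i ω => ?_⟩
  rw [truncEst]
  split_ifs
  · exact le_max_of_le_left
      (hM ⟨(P.board ω k, i), ⟨P.length_board_le ω k, Set.mem_univ _⟩, rfl⟩)
  · simp

theorem lintegral_length_board_le {σ : ℝ≥0} {θ : Fin d → ℝ} (hθ : θ ∈ Set.Icc (-1 : Fin d → ℝ) 1)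
    (k : ℕ) : ∫⁻ ω, ((P.board ω k).length : ℝ≥0∞) ∂(P.law σ θ) ≤ P.commCost σ :=
  (lintegral_mono fun ω => le_iSup (fun k => ((P.board ω k).length : ℝ≥0∞)) k).trans
    (le_iSup₂ (f := fun θ (_ : θ ∈ Set.Icc (-1 : Fin d → ℝ) 1) =>
      ∫⁻ ω, P.numBits ω ∂(P.law σ θ)) θ hθ)

theorem integrable_length_board (σ : ℝ≥0) (θ : Fin d → ℝ) (k : ℕ) :
    Integrable (fun ω => ((P.board ω k).length : ℝ)) (P.law σ θ) :=
  Integrable.of_bound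
    ((measurable_from_top (f := fun l : ℕ => (l : ℝ))).comp
      (P.measurable_length_board k)).aestronglyMeasurable k
    (Filter.Eventually.of_forall fun ω => by
      simpa using P.length_board_le ω k)

theorem integral_length_board_le {σ : ℝ≥0} {θ : Fin d → ℝ} (hθ : θ ∈ Set.Icc (-1 : Fin d → ℝ) 1)
    (hB : P.commCost σ ≠ ∞) (k : ℕ) :
    ∫ ω, ((P.board ω k).length : ℝ) ∂(P.law σ θ) ≤ (P.commCost σ).toReal := by
  rw [integral_eq_lintegral_of_nonneg_ae (Filter.Eventually.of_forall fun ω => Nat.cast_nonneg _)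
    (P.integrable_length_board σ θ k).aestronglyMeasurable]
  refine ENNReal.toReal_mono hB ?_
  simpa only [ENNReal.ofReal_natCast] using P.lintegral_length_board_le hθ k

/-- A run still going after `k` steps has written exactly `k` bits, and estimating by 0 then costs
at most d = (d/k) · k. The extra loss is therefore charged to the bits and disappears as `k` grows.
-/
theorem lintegral_truncEst_le (est : List Bool → Fin d → ℝ) {σ : ℝ≥0} {θ : Fin d → ℝ}
    (hθ : θ ∈ Set.Icc (-1 : Fin d → ℝ) 1) {k : ℕ} (hk : 0 < k) :
    ∫⁻ ω, ENNReal.ofReal (∑ i, (P.truncEst est k i ω - θ i) ^ 2) ∂(P.law σ θ)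
      ≤ P.loss est σ + (d / k : ℝ≥0∞) * P.commCost σ := by
  have hpt : ∀ ω : P.Outcome, ENNReal.ofReal (∑ i, (P.truncEst est k i ω - θ i) ^ 2)
      ≤ ENNReal.ofReal (∑ i, (est (P.transcript ω) i - θ i) ^ 2)
        + (d / k : ℝ≥0∞) * ((P.board ω k).length : ℝ≥0∞) := by
    intro ω
    by_cases h : P.halt ω.1 (P.board ω k) = true
    · simp only [truncEst, h, if_true, P.transcript_eq_board h]
      exact le_self_add
    · refine le_trans ?_ le_add_self
      rw [P.length_board_of_not_halt (Bool.eq_false_of_not_eq_true h),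
        ENNReal.div_mul_cancel (by exact_mod_cast hk.ne') (ENNReal.natCast_ne_top k)]
      refine ENNReal.ofReal_le_of_le_toReal ?_
      simp only [truncEst, h, ENNReal.toReal_natCast]
      calc ∑ i, ((if false = true then est (P.board ω k) i else 0) - θ i) ^ 2
          ≤ ∑ _i : Fin d, (1 : ℝ) := by
            refine Finset.sum_le_sum fun i _ => ?_
            have h1 : -1 ≤ θ i := hθ.1 i
            have h2 : θ i ≤ 1 := hθ.2 i
            simp only [Bool.false_eq_true, if_false]
            nlinarith
        _ = d := by simp
  refine (lintegral_mono hpt).trans ?_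
  have hmeas : Measurable fun ω : P.Outcome => ((P.board ω k).length : ℝ≥0∞) :=
    (measurable_from_top (f := fun l : ℕ => (l : ℝ≥0∞))).comp (P.measurable_length_board k)
  rw [lintegral_add_right _ (hmeas.const_mul _), lintegral_const_mul _ hmeas]
  gcongr
  · exact le_iSup₂ (f := fun θ (_ : θ ∈ Set.Icc (-1 : Fin d → ℝ) 1) =>
      ∫⁻ ω, ENNReal.ofReal (∑ i, (est (P.transcript ω) i - θ i) ^ 2) ∂(P.law σ θ)) θ hθ
  · exact P.lintegral_length_board_le hθ k

theorem measurePreserving_data (σ : ℝ≥0) (θ : Fin d → ℝ) :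
    MeasurePreserving (fun ω : P.Outcome => ω.2.2) (P.law σ θ) (dataLaw m n σ θ) :=
  (measurePreserving_snd (μ := Measure.pi P.privLaw)).comp
    (measurePreserving_snd (μ := P.pubLaw))

theorem integrable_truncEst_mul_dataScore (est : List Bool → Fin d → ℝ) {σ : ℝ≥0} (hσ : 0 < σ)
    (θ : Fin d → ℝ) (k : ℕ) (i : Fin d) :
    Integrable (fun ω : P.Outcome => P.truncEst est k i ω * dataScore σ θ i ω.2.2)
      (P.law σ θ) := by
  obtain ⟨M, hM⟩ := P.exists_abs_truncEst_le est k
  exact ((P.measurePreserving_data σ θ).integrable_comp_of_integrable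
    (integrable_dataScore hσ θ i)).bdd_mul (P.measurable_truncEst est k i).aestronglyMeasurable
    (Filter.Eventually.of_forall (hM i))

theorem integrable_truncEst_sq (est : List Bool → Fin d → ℝ) (σ : ℝ≥0)
    (θ : Fin d → ℝ) (k : ℕ) (i : Fin d) :
    Integrable (fun ω : P.Outcome => P.truncEst est k i ω ^ 2) (P.law σ θ) := by
  obtain ⟨M, hM⟩ := P.exists_abs_truncEst_le est k
  refine Integrable.of_bound ((P.measurable_truncEst est k i).pow_const 2).aestronglyMeasurable
    (M ^ 2) (Filter.Eventually.of_forall fun ω => ?_)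
  rw [norm_pow]
  exact pow_le_pow_left₀ (norm_nonneg _) (hM i ω) 2

theorem integrable_crossTerms {σ : ℝ≥0} (hσ : 0 < σ) (θ : Fin d → ℝ) :
    Integrable (crossTerms (machineScore σ θ) : (Fin m → Samples n d) → ℝ) (dataLaw m n σ θ) :=
  integrable_finsetSum _ fun i _ =>
    integrable_crossTerm fun _ => (subGaussian_machineScore hσ θ).memLp i

theorem integral_crossTerms {σ : ℝ≥0} (hσ : 0 < σ) (hn : 1 ≤ n) (θ : Fin d → ℝ) :
    ∫ x : Fin m → Samples n d, crossTerms (machineScore σ θ) x ∂(dataLaw m n σ θ) = 0 := by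
  have hs := subGaussian_machineScore (n := n) hσ θ
  have hV : 0 < (n : ℝ) / (σ : ℝ) ^ 2 :=
    div_pos (Nat.cast_pos.2 hn) (pow_pos (NNReal.coe_pos.2 hσ) 2)
  -- Conditioning on the sure event has log-probability 0, so the bound forces every score to have
  -- mean zero.
  have h0 := hs.sum_sq_condMean_le hV (A := Set.univ) (by simp)
  rw [cond_univ, probReal_univ, Real.log_one, mul_zero, neg_zero] at h0
  have hzero : ∀ i, ∫ y, machineScore σ θ i y ∂(Measure.pi fun _ : Fin n => gaussianVec σ θ) = 0 :=
    fun i => by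
      have := (Finset.sum_eq_zero_iff_of_nonneg (fun i _ => sq_nonneg _)).1
        (le_antisymm h0 (Finset.sum_nonneg fun i _ => sq_nonneg _)) i (Finset.mem_univ i)
      exact pow_eq_zero_iff two_ne_zero |>.1 this
  unfold crossTerms dataLaw
  rw [integral_finsetSum _ fun i _ =>
    integrable_crossTerm fun _ => (subGaussian_machineScore hσ θ).memLp i]
  refine Finset.sum_eq_zero fun i _ => ?_
  refine (integral_crossTerm fun _ => hs.memLp i).trans ?_
  simp [hzero]

/-- The Fisher information of the transcript is controlled by the number of bits. -/
theorem integral_truncEst_mul_dataScore_le (est : List Bool → Fin d → ℝ) {σ : ℝ≥0} (hσ : 0 < σ)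
    (hn : 1 ≤ n) (θ : Fin d → ℝ) (k : ℕ) {e : Fin d → ℝ} (he : ∀ i, e i ^ 2 = 1) {a : ℝ}
    (ha : 0 < a) :
    ∑ i, e i * ∫ ω, P.truncEst est k i ω * dataScore σ θ i ω.2.2 ∂(P.law σ θ)
      ≤ a / 2 * ∑ i, ∫ ω, P.truncEst est k i ω ^ 2 ∂(P.law σ θ)
        + (n : ℝ) / (σ : ℝ) ^ 2 / a * Real.log 2 *
          ∫ ω, ((P.board ω k).length : ℝ) ∂(P.law σ θ) := by
  set V : ℝ := (n : ℝ) / (σ : ℝ) ^ 2 with hVdef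
  have hV : 0 < V := div_pos (Nat.cast_pos.2 hn) (pow_pos (NNReal.coe_pos.2 hσ) 2)
  -- The vector v at a leaf is the truncated estimate with signs e. As e_i² = 1, the signs do not
  -- affect the quadratic term.
  let g : P.Outcome → ℝ := fun ω =>
    runScore (P.halt ω.1) (P.speaker ω.1) (fun j y w => P.bit j ω.1 (ω.2.1 j) y w)
      (machineScore σ θ) a (V / a * Real.log 2)
      (fun w i => e i * if P.halt ω.1 w then est w i else 0) k [] ω.2.2
  have hg : g = fun ω => ((∑ i, e i * (P.truncEst est k i ω * dataScore σ θ i ω.2.2)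
      - a / 2 * ∑ i, P.truncEst est k i ω ^ 2)
      - crossTerms (machineScore σ θ) ω.2.2 / (2 * a))
      - V / a * Real.log 2 * ((P.board ω k).length : ℝ) := by
    ext ω
    simp only [g, runScore, ← P.board_eq_run, leafScore, mul_pow, he, one_mul, truncEst, dataScore,
      List.length_nil, Nat.cast_zero, sub_zero, mul_assoc]
  have i1 : Integrable (fun ω : P.Outcome =>
      ∑ i, e i * (P.truncEst est k i ω * dataScore σ θ i ω.2.2)) (P.law σ θ) :=
    integrable_finsetSum _ fun i _ =>
      (P.integrable_truncEst_mul_dataScore est hσ θ k i).const_mul _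
  have i2 : Integrable (fun ω : P.Outcome => a / 2 * ∑ i, P.truncEst est k i ω ^ 2) (P.law σ θ) :=
    (integrable_finsetSum _ fun i _ => P.integrable_truncEst_sq est σ θ k i).const_mul _
  have i3 : Integrable (fun ω : P.Outcome => crossTerms (machineScore σ θ) ω.2.2 / (2 * a))
      (P.law σ θ) :=
    ((P.measurePreserving_data σ θ).integrable_comp_of_integrable
      (integrable_crossTerms hσ θ)).div_const _
  have i4 : Integrable (fun ω : P.Outcome => V / a * Real.log 2 * ((P.board ω k).length : ℝ))
      (P.law σ θ) := (P.integrable_length_board σ θ k).const_mul _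
  have ig : Integrable g (P.law σ θ) := by
    rw [hg]; exact ((i1.sub i2).sub i3).sub i4
  -- With public and private randomness frozen, the protocol is deterministic and the tree bound
  -- applies to the data alone.
  have hle : ∫ ω, g ω ∂(P.law σ θ) ≤ 0 := by
    unfold law at ig ⊢
    rw [integral_prod _ ig]
    refine integral_nonpos_of_ae ?_
    filter_upwards [ig.prod_right_ae] with r hr
    rw [integral_prod _ hr]
    refine integral_nonpos fun u => ?_
    exact integral_runScore_nonpos (μ := fun _ => Measure.pi fun _ => gaussianVec σ θ)
      (halt := P.halt r) (speaker := P.speaker r) (bit := fun j y w => P.bit j r (u j) y w) hV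
      (fun _ => subGaussian_machineScore hσ θ) ha
      (fun j w => (P.measurable_bit j w).comp
        (measurable_const.prodMk (measurable_const.prodMk measurable_id)))
      (fun w i => e i * if P.halt r w then est w i else 0) k []
  have h3 : ∫ ω : P.Outcome, crossTerms (machineScore σ θ) ω.2.2 ∂(P.law σ θ) = 0 := by
    rw [← integral_crossTerms (m := m) hσ hn θ, ← (P.measurePreserving_data σ θ).map_eq,
      integral_map (P.measurePreserving_data σ θ).aemeasurable]
    rw [(P.measurePreserving_data σ θ).map_eq]
    exact (integrable_crossTerms hσ θ).aestronglyMeasurable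
  have e4 := integral_sub ((i1.sub i2).sub i3) i4
  have e3 := integral_sub (i1.sub i2) i3
  simp only [Pi.sub_apply] at e3 e4
  rw [hg, e4, e3, integral_sub i1 i2, integral_div, h3, zero_div, integral_const_mul,
    integral_const_mul, integral_finsetSum _ fun i _ =>
      (P.integrable_truncEst_mul_dataScore est hσ θ k i).const_mul _,
    integral_finsetSum _ fun i _ => P.integrable_truncEst_sq est σ θ k i] at hle
  simp only [integral_const_mul] at hle
  linarith

end Protocol

/-! ### The prior and its Stein-type inequality. -/

section Prior

/-- The mixture of the uniform law on `{-h, h}` and, with weight `ε`, the uniform law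
on `[-h, h]`. -/
noncomputable def prior (h ε : ℝ) : Measure ℝ :=
  ENNReal.ofReal ((1 - ε) / 2) • (Measure.dirac h + Measure.dirac (-h))
    + ENNReal.ofReal (ε / (2 * h)) • volume.restrict (Set.Icc (-h) h)

variable {h ε : ℝ}

theorem isProbabilityMeasure_prior (hh : 0 < h) (hε : 0 < ε) (hε1 : ε ≤ 1) :
    IsProbabilityMeasure (prior h ε) := by
  constructor
  simp only [prior, Measure.add_apply, Measure.smul_apply, measure_univ, Measure.restrict_apply,
    MeasurableSet.univ, Set.univ_inter, Real.volume_Icc, smul_eq_mul]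
  rw [← ENNReal.ofReal_mul (by positivity), one_add_one_eq_two, ← ENNReal.ofReal_ofNat,
    ← ENNReal.ofReal_mul (by linarith), ← ENNReal.ofReal_add (by linarith)
      (mul_nonneg (by positivity) (by linarith)), ← ENNReal.ofReal_one]
  congr 1
  field_simp
  ring

theorem ae_mem_prior (hh : 0 < h) : ∀ᵐ t ∂(prior h ε), t ∈ Set.Icc (-h) h := by
  rw [prior, ae_add_measure_iff]
  constructor
  · refine Measure.ae_smul_measure ?_ _
    rw [ae_add_measure_iff]
    constructor <;>
    · rw [ae_dirac_iff (p := fun t => t ∈ Set.Icc (-h) h) measurableSet_Icc]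
      constructor <;> linarith
  · exact Measure.ae_smul_measure (ae_restrict_mem measurableSet_Icc) _

theorem integrable_prior_of_continuous (hh : 0 < h) [IsFiniteMeasure (prior h ε)] {f : ℝ → ℝ}
    (hf : Continuous f) : Integrable f (prior h ε) := by
  obtain ⟨C, hC⟩ := (isCompact_Icc (a := -h) (b := h)).exists_bound_of_continuousOn hf.continuousOn
  refine Integrable.of_bound hf.aestronglyMeasurable C ?_
  filter_upwards [ae_mem_prior hh] with t ht using hC t ht

theorem integral_id_prior (hh : 0 < h) [IsFiniteMeasure (prior h ε)] :
    ∫ t, t ∂(prior h ε) = 0 := by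
  have hint : Integrable (fun t => t) (prior h ε) := integrable_prior_of_continuous hh continuous_id
  rw [prior] at hint
  have h1 := hint.left_of_add_measure
  have h2 := hint.right_of_add_measure
  rw [prior, integral_add_measure h1 h2, integral_smul_measure, integral_smul_measure,
    integral_add_measure (integrable_dirac (by simp)) (integrable_dirac (by simp)),
    integral_dirac, integral_dirac, integral_Icc_eq_integral_Ioc,
    ← intervalIntegral.integral_of_le (by linarith), integral_id]
  simp

/-- The two atoms alone already contribute (1 − ε)h². -/
theorem le_integral_sq_prior (hh : 0 < h) (hε1 : ε ≤ 1) [IsFiniteMeasure (prior h ε)] :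
    (1 - ε) * h ^ 2 ≤ ∫ t, t ^ 2 ∂(prior h ε) := by
  have hint : Integrable (fun t => t ^ 2) (prior h ε) :=
    integrable_prior_of_continuous hh (continuous_pow 2)
  have hle : ENNReal.ofReal ((1 - ε) / 2) • (Measure.dirac h + Measure.dirac (-h)) ≤ prior h ε :=
    Measure.le_add_right le_rfl
  refine le_trans (le_of_eq ?_) (integral_mono_measure hle
    (Filter.Eventually.of_forall fun t => sq_nonneg t) hint)
  rw [integral_smul_measure,
    integral_add_measure (integrable_dirac (by simp)) (integrable_dirac (by simp)),
    integral_dirac, integral_dirac, ENNReal.toReal_ofReal (by linarith), smul_eq_mul]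
  ring

theorem setIntegral_le_integral_prior (hh : 0 < h) (hε : 0 < ε) {f : ℝ → ℝ}
    (hf0 : ∀ t, 0 ≤ f t) (hf : Integrable f (prior h ε)) :
    ∫ t in Set.Icc (-h) h, f t ≤ 2 * h / ε * ∫ t, f t ∂(prior h ε) := by
  have hle : ENNReal.ofReal (ε / (2 * h)) • volume.restrict (Set.Icc (-h) h) ≤ prior h ε :=
    Measure.le_add_left le_rfl
  have h1 := integral_mono_measure hle (Filter.Eventually.of_forall hf0) hf
  rw [integral_smul_measure, ENNReal.toReal_ofReal (by positivity), smul_eq_mul] at h1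
  calc ∫ t in Set.Icc (-h) h, f t
      = 2 * h / ε * (ε / (2 * h) * ∫ t in Set.Icc (-h) h, f t) := by field_simp
    _ ≤ _ := by gcongr

/-- A Stein-type inequality: the covariance of the parameter with a function `F` is bounded by the
mean of the absolute derivative of `F`. -/
theorem integral_id_mul_le (hh : 0 < h) (hε : 0 < ε) [IsProbabilityMeasure (prior h ε)]
    {F G : ℝ → ℝ} (hF : ∀ t ∈ Set.Icc (-h) h, F t - F (-h) = ∫ s in (-h)..t, G s)
    (hFint : Integrable (fun t => t * F t) (prior h ε)) (hG : Integrable G (prior h ε))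
    (hG' : IntegrableOn G (Set.Icc (-h) h)) :
    ∫ t, t * F t ∂(prior h ε) ≤ 2 * h ^ 2 / ε * ∫ t, |G t| ∂(prior h ε) := by
  have hid : Integrable (fun t : ℝ => t * F (-h)) (prior h ε) :=
    (integrable_prior_of_continuous hh continuous_id).mul_const _
  have e1 : ∫ t, t * F t ∂(prior h ε) = ∫ t, (t * F t - t * F (-h)) ∂(prior h ε) := by
    rw [integral_sub hFint hid, integral_mul_const, integral_id_prior hh]; ring
  set Γ := ∫ t in Set.Icc (-h) h, |G t| with hΓ
  -- The prior has mean zero, so F may be recentred at -h; its increments are then bounded by the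
  -- total variation Γ on the interval. The uniform part converts Γ into a prior mean at the cost
  -- 2h/ε.
  have hb : ∀ t ∈ Set.Icc (-h) h, |F t - F (-h)| ≤ Γ := by
    intro t ht
    rw [hF t ht]
    refine (intervalIntegral.abs_integral_le_integral_abs ht.1).trans ?_
    rw [intervalIntegral.integral_of_le ht.1]
    refine setIntegral_mono_set hG'.abs (Filter.Eventually.of_forall fun t => abs_nonneg _) ?_
    exact (Set.Ioc_subset_Icc_self.trans (Set.Icc_subset_Icc le_rfl ht.2)).eventuallyLE
  have e2 : ∫ t, (t * F t - t * F (-h)) ∂(prior h ε) ≤ ∫ _t, h * Γ ∂(prior h ε) := by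
    refine integral_mono_ae (hFint.sub hid) (integrable_const _) ?_
    filter_upwards [ae_mem_prior hh] with t ht
    calc t * F t - t * F (-h) ≤ |t * (F t - F (-h))| := by rw [mul_sub]; exact le_abs_self _
      _ = |t| * |F t - F (-h)| := abs_mul _ _
      _ ≤ h * Γ := mul_le_mul (abs_le.2 ht) (hb t ht) (abs_nonneg _) hh.le
  rw [integral_const, probReal_univ, one_smul] at e2
  have e3 := setIntegral_le_integral_prior hh hε (fun t => abs_nonneg (G t)) hG.abs
  calc _ ≤ h * Γ := e1 ▸ e2
    _ ≤ h * (2 * h / ε * ∫ t, |G t| ∂(prior h ε)) := by gcongr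
    _ = _ := by ring

/-- Resampling one coordinate preserves the product prior; this reduces the vector case to one
coordinate with the others frozen. -/
theorem measurePreserving_update_pi {ι : Type*} [Fintype ι] [DecidableEq ι] (ν : Measure ℝ)
    [IsProbabilityMeasure ν] (i : ι) :
    MeasurePreserving (fun p : (ι → ℝ) × ℝ => Function.update p.1 i p.2)
      ((Measure.pi fun _ : ι => ν).prod ν) (Measure.pi fun _ => ν) := by
  have hmeas : Measurable fun p : (ι → ℝ) × ℝ => Function.update p.1 i p.2 := by
    refine measurable_pi_iff.2 fun j => ?_
    by_cases hj : j = i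
    · subst hj; simpa using measurable_snd
    · simp only [Function.update_of_ne hj]; fun_prop
  refine ⟨hmeas, (Measure.pi_eq fun s hs => ?_).symm⟩
  have hpre : (fun p : (ι → ℝ) × ℝ => Function.update p.1 i p.2) ⁻¹' Set.univ.pi s
      = (Set.univ.pi (Function.update s i Set.univ)) ×ˢ s i := by
    ext ⟨θ, t⟩
    simp only [Set.mem_preimage, Set.mem_univ_pi, Set.mem_prod]
    constructor
    · intro H
      refine ⟨fun j => ?_, by simpa using H i⟩
      by_cases hj : j = i
      · subst hj; simp
      · simpa [hj] using H j
    · rintro ⟨H, ht⟩ j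
      by_cases hj : j = i
      · subst hj; simpa using ht
      · simpa [hj] using H j
  rw [Measure.map_apply hmeas (MeasurableSet.univ_pi hs), hpre, Measure.prod_prod, Measure.pi_pi,
    ← Finset.mul_prod_erase _ _ (Finset.mem_univ i), ← Finset.mul_prod_erase _ (fun j => ν (s j))
      (Finset.mem_univ i)]
  rw [Function.update_self, measure_univ, one_mul, mul_comm]
  congr 1
  refine Finset.prod_congr rfl fun j hj => ?_
  rw [Function.update_of_ne (Finset.ne_of_mem_erase hj)]

theorem integral_pi_eq_integral_update {ι : Type*} [Fintype ι] [DecidableEq ι] (ν : Measure ℝ)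
    [IsProbabilityMeasure ν] (i : ι) {f : (ι → ℝ) → ℝ} (hf : Integrable f (Measure.pi fun _ => ν)) :
    Integrable (fun p : (ι → ℝ) × ℝ => f (Function.update p.1 i p.2))
        ((Measure.pi fun _ : ι => ν).prod ν) ∧
      ∫ θ, f θ ∂(Measure.pi fun _ => ν)
        = ∫ θ, ∫ t, f (Function.update θ i t) ∂ν ∂(Measure.pi fun _ => ν) := by
  have hmp := measurePreserving_update_pi ν i
  have hint : Integrable (fun p : (ι → ℝ) × ℝ => f (Function.update p.1 i p.2))
      ((Measure.pi fun _ : ι => ν).prod ν) := hmp.integrable_comp_of_integrable hf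
  refine ⟨hint, ?_⟩
  rw [← integral_prod _ hint]
  conv_lhs => rw [← hmp.map_eq]
  refine integral_map hmp.aemeasurable ?_
  rw [hmp.map_eq]
  exact hf.aestronglyMeasurable

theorem ae_mem_pi_prior {d : ℕ} (hh : 0 < h) [IsProbabilityMeasure (prior h ε)] :
    ∀ᵐ θ ∂(Measure.pi fun _ : Fin d => prior h ε), ∀ i, θ i ∈ Set.Icc (-h) h :=
  Filter.eventually_all.2 fun i =>
    (measurePreserving_eval (fun _ : Fin d => prior h ε) i).quasiMeasurePreserving.ae
      (ae_mem_prior hh)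

end Prior

/-! ### Differentiating expectations in the parameter. -/

/-- The fundamental theorem of calculus for integrals against a family of densities. -/
theorem integral_mul_density_sub {Ω : Type*} [MeasurableSpace Ω] {Q : Measure Ω} [SFinite Q]
    {L D : ℝ → Ω → ℝ} {φ : Ω → ℝ} {M C : ℝ} (hφ : Measurable φ) (hM0 : 0 ≤ M)
    (hM : ∀ ω, |φ ω| ≤ M)
    (hLint : ∀ t, Integrable (L t) Q) (hD : Measurable (Function.uncurry D))
    (hderiv : ∀ t ω, HasDerivAt (fun t => L t ω) (D t ω) t)
    (hcont : ∀ ω, Continuous fun t => D t ω) (hDint : ∀ t, Integrable (D t) Q)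
    (hC : ∀ t, ∫ ω, |D t ω| ∂Q ≤ C) (a b : ℝ) :
    ∫ ω, φ ω * L b ω ∂Q - ∫ ω, φ ω * L a ω ∂Q = ∫ t in a..b, ∫ ω, φ ω * D t ω ∂Q := by
  have hint : ∀ t, Integrable (fun ω => φ ω * L t ω) Q := fun t =>
    (hLint t).bdd_mul hφ.aestronglyMeasurable (Filter.Eventually.of_forall hM)
  have hDint' : ∀ t, Integrable (fun ω => φ ω * D t ω) Q := fun t =>
    (hDint t).bdd_mul hφ.aestronglyMeasurable (Filter.Eventually.of_forall hM)
  have hmeas : Measurable (Function.uncurry fun t ω => φ ω * D t ω) :=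
    (hφ.comp measurable_snd).mul hD
  rw [← integral_sub (hint b) (hint a), intervalIntegral_integral_swap]
  · refine integral_congr_ae (Filter.Eventually.of_forall fun ω => ?_)
    simp only
    rw [intervalIntegral.integral_const_mul, intervalIntegral.integral_eq_sub_of_hasDerivAt
      (fun t _ => hderiv t ω) ((hcont ω).intervalIntegrable _ _), mul_sub]
  · rw [integrable_prod_iff hmeas.aestronglyMeasurable]
    refine ⟨Filter.Eventually.of_forall hDint', ?_⟩
    have : IsFiniteMeasure (volume.restrict (Set.uIoc a b)) := by
      unfold Set.uIoc; infer_instance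
    refine Integrable.of_bound (C := M * C)
      hmeas.stronglyMeasurable.norm.integral_prod_right.aestronglyMeasurable
      (Filter.Eventually.of_forall fun t => ?_)
    rw [Real.norm_of_nonneg (integral_nonneg fun ω => norm_nonneg _)]
    calc ∫ ω, ‖φ ω * D t ω‖ ∂Q ≤ ∫ ω, M * |D t ω| ∂Q := by
          refine integral_mono (hDint' t).norm ((hDint t).abs.const_mul M) fun ω => ?_
          simp only [norm_mul, Real.norm_eq_abs]
          exact mul_le_mul_of_nonneg_right (hM ω) (abs_nonneg _)
      _ = M * ∫ ω, |D t ω| ∂Q := integral_const_mul _ _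
      _ ≤ M * C := by gcongr; exact hC t

namespace Protocol

variable {m n d : ℕ} (P : Protocol m n d)

/-- The law of the randomness together with Lebesgue measure on the data. -/
noncomputable def baseLaw : Measure P.Outcome :=
  P.pubLaw.prod ((Measure.pi P.privLaw).prod volume)

instance : SFinite P.baseLaw := by
  have : SigmaFinite (volume : Measure (Fin m → Samples n d)) := inferInstance
  unfold baseLaw; infer_instance

theorem measurable_data : Measurable fun ω : P.Outcome => ω.2.2 :=
  measurable_snd.comp measurable_snd

theorem measurable_param_data :
    Measurable fun p : (Fin d → ℝ) × P.Outcome => (p.1, p.2.2.2) :=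
  measurable_fst.prodMk (P.measurable_data.comp measurable_snd)

theorem measurable_density (σ : ℝ≥0) :
    Measurable fun p : (Fin d → ℝ) × P.Outcome => dataDensity σ p.1 p.2.2.2 := by
  have h := Measurable.comp (measurable_dataDensity (m := m) (n := n) (d := d) σ)
    P.measurable_param_data
  exact h

theorem measurable_score (σ : ℝ≥0) (i : Fin d) :
    Measurable fun p : (Fin d → ℝ) × P.Outcome => dataScore σ p.1 i p.2.2.2 := by
  have h := Measurable.comp (measurable_dataScore (m := m) (n := n) (d := d) σ i)
    P.measurable_param_data
  exact h

theorem measurable_density_right (σ : ℝ≥0) (θ : Fin d → ℝ) :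
    Measurable fun ω : P.Outcome => ENNReal.ofReal (dataDensity σ θ ω.2.2) := by
  have h := (P.measurable_density σ).comp (measurable_prodMk_left (x := θ))
  exact h.ennreal_ofReal

theorem law_eq_withDensity {σ : ℝ≥0} (hσ : 0 < σ) (θ : Fin d → ℝ) :
    P.law σ θ = P.baseLaw.withDensity fun ω => ENNReal.ofReal (dataDensity σ θ ω.2.2) := by
  have hm : Measurable fun x : Fin m → Samples n d => ENNReal.ofReal (dataDensity σ θ x) :=
    ((measurable_dataDensity σ).comp measurable_prodMk_left).ennreal_ofReal
  have := dataLaw_eq_withDensity (m := m) (n := n) hσ θ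
  rw [law, this]
  have hs : SFinite ((volume : Measure (Fin m → Samples n d)).withDensity
    fun x => ENNReal.ofReal (dataDensity σ θ x)) := by rw [← this]; infer_instance
  rw [prod_withDensity_right hm]
  have hs' : SFinite (((Measure.pi P.privLaw).prod
      (volume : Measure (Fin m → Samples n d))).withDensity
        fun z => ENNReal.ofReal (dataDensity σ θ z.2)) := by
    rw [← prod_withDensity_right hm]; infer_instance
  have hm' : Measurable fun z : (∀ j, P.Priv j) × (Fin m → Samples n d) =>
      ENNReal.ofReal (dataDensity σ θ z.2) := hm.comp measurable_snd
  rw [prod_withDensity_right hm']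
  rfl

theorem integral_law {σ : ℝ≥0} (hσ : 0 < σ) (θ : Fin d → ℝ) (f : P.Outcome → ℝ) :
    ∫ ω, f ω ∂(P.law σ θ) = ∫ ω, f ω * dataDensity σ θ ω.2.2 ∂P.baseLaw := by
  rw [P.law_eq_withDensity hσ, integral_withDensity_eq_integral_toReal_smul
    (P.measurable_density_right σ θ)
    (Filter.Eventually.of_forall fun _ => ENNReal.ofReal_lt_top)]
  refine integral_congr_ae (Filter.Eventually.of_forall fun ω => ?_)
  simp only [smul_eq_mul, ENNReal.toReal_ofReal (dataDensity_nonneg _ _ _), mul_comm]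

theorem integrable_law_iff {σ : ℝ≥0} (hσ : 0 < σ) (θ : Fin d → ℝ) {f : P.Outcome → ℝ} :
    Integrable f (P.law σ θ) ↔ Integrable (fun ω => f ω * dataDensity σ θ ω.2.2) P.baseLaw := by
  rw [P.law_eq_withDensity hσ, integrable_withDensity_iff_integrable_smul'
    (P.measurable_density_right σ θ)
    (Filter.Eventually.of_forall fun _ => ENNReal.ofReal_lt_top)]
  refine integrable_congr (Filter.Eventually.of_forall fun ω => ?_)
  simp only [smul_eq_mul, ENNReal.toReal_ofReal (dataDensity_nonneg _ _ _), mul_comm]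

theorem measurable_integral_law {σ : ℝ≥0} (hσ : 0 < σ) {f : (Fin d → ℝ) → P.Outcome → ℝ}
    (hf : Measurable (Function.uncurry f)) :
    Measurable fun θ => ∫ ω, f θ ω ∂(P.law σ θ) := by
  simp only [P.integral_law hσ]
  have h : Measurable (Function.uncurry fun θ (ω : P.Outcome) =>
      f θ ω * dataDensity σ θ ω.2.2) := hf.mul (P.measurable_density σ)
  exact h.stronglyMeasurable.integral_prod_right.measurable

theorem integral_abs_score_le {σ : ℝ≥0} (hσ : 0 < σ) (θ : Fin d → ℝ) (i : Fin d) :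
    ∫ ω, |dataScore σ θ i ω.2.2| ∂(P.law σ θ)
      ≤ m * (2 * Real.exp ((n : ℝ) / (σ : ℝ) ^ 2 / 2)) := by
  refine le_trans (le_of_eq ?_) (integral_abs_dataScore_le hσ θ i)
  conv_rhs => rw [← (P.measurePreserving_data σ θ).map_eq]
  refine (integral_map (f := fun x => |dataScore σ θ i x|)
    (P.measurePreserving_data σ θ).aemeasurable ?_).symm
  rw [(P.measurePreserving_data σ θ).map_eq]
  exact (integrable_dataScore hσ θ i).abs.aestronglyMeasurable

theorem integrable_score {σ : ℝ≥0} (hσ : 0 < σ) (θ : Fin d → ℝ) (i : Fin d) :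
    Integrable (fun ω : P.Outcome => dataScore σ θ i ω.2.2) (P.law σ θ) :=
  (P.measurePreserving_data σ θ).integrable_comp_of_integrable (integrable_dataScore hσ θ i)

/-- The integrated form of ∂/∂θ_i E_θ[φ] = E_θ[φ S_i]: all laws have densities over the common
`baseLaw`, and the first absolute moment of the score is bounded uniformly in the parameter. -/
theorem integral_law_update_sub {σ : ℝ≥0} (hσ : 0 < σ) (θ : Fin d → ℝ) (i : Fin d)
    {φ : P.Outcome → ℝ} (hφ : Measurable φ) {M : ℝ} (hM0 : 0 ≤ M) (hM : ∀ ω, |φ ω| ≤ M)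
    (a b : ℝ) :
    ∫ ω, φ ω ∂(P.law σ (Function.update θ i b)) - ∫ ω, φ ω ∂(P.law σ (Function.update θ i a))
      = ∫ t in a..b, ∫ ω, φ ω * dataScore σ (Function.update θ i t) i ω.2.2
          ∂(P.law σ (Function.update θ i t)) := by
  have hupd : Continuous fun t : ℝ => Function.update θ i t :=
    continuous_const.update i continuous_id
  have hsc : ∀ t, Integrable (fun ω : P.Outcome => dataScore σ (Function.update θ i t) i ω.2.2
      * dataDensity σ (Function.update θ i t) ω.2.2) P.baseLaw := fun t =>
    (P.integrable_law_iff hσ _).1 (P.integrable_score hσ _ i)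
  have hcomp : Measurable fun p : ℝ × P.Outcome => (Function.update θ i p.1, p.2) :=
    (hupd.measurable.comp measurable_fst).prodMk measurable_snd
  have hD : Measurable (Function.uncurry fun (t : ℝ) (ω : P.Outcome) =>
      dataScore σ (Function.update θ i t) i ω.2.2
        * dataDensity σ (Function.update θ i t) ω.2.2) := by
    have h1 := Measurable.comp (P.measurable_score σ i) hcomp
    have h2 := Measurable.comp (P.measurable_density σ) hcomp
    exact h1.mul h2
  have hL : ∀ t, Integrable (fun ω : P.Outcome =>
      dataDensity σ (Function.update θ i t) ω.2.2) P.baseLaw := fun t => by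
    have h := (P.integrable_law_iff hσ (Function.update θ i t)).1 (integrable_const (1 : ℝ))
    simpa only [one_mul] using h
  have hder : ∀ (t : ℝ) (ω : P.Outcome),
      HasDerivAt (fun t => dataDensity σ (Function.update θ i t) ω.2.2)
        (dataScore σ (Function.update θ i t) i ω.2.2
          * dataDensity σ (Function.update θ i t) ω.2.2) t := fun t ω => by
    rw [mul_comm]; exact hasDerivAt_dataDensity σ θ i ω.2.2 t
  have hcont : ∀ ω : P.Outcome, Continuous fun t => dataScore σ (Function.update θ i t) i ω.2.2
      * dataDensity σ (Function.update θ i t) ω.2.2 := fun ω => by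
    have h1 := Continuous.comp (continuous_dataScore σ i ω.2.2) hupd
    have h2 := Continuous.comp (continuous_dataDensity σ ω.2.2) hupd
    exact h1.mul h2
  have hC : ∀ t, ∫ ω : P.Outcome, |dataScore σ (Function.update θ i t) i ω.2.2
      * dataDensity σ (Function.update θ i t) ω.2.2| ∂P.baseLaw
        ≤ m * (2 * Real.exp ((n : ℝ) / (σ : ℝ) ^ 2 / 2)) := fun t => by
    have h := P.integral_abs_score_le hσ (Function.update θ i t) i
    rw [P.integral_law hσ] at h
    simpa only [abs_mul, abs_of_nonneg (dataDensity_nonneg _ _ _)] using h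
  simp only [P.integral_law hσ, mul_assoc]
  exact integral_mul_density_sub hφ hM0 hM hL hD hder hcont hsc hC a b

variable {h ε : ℝ}

theorem integral_mul_integral_law_le {σ : ℝ≥0} (hσ : 0 < σ) (hh : 0 < h) (hε : 0 < ε)
    [IsProbabilityMeasure (prior h ε)] (i : Fin d)
    {φ : P.Outcome → ℝ} (hφ : Measurable φ) {M : ℝ} (hM0 : 0 ≤ M) (hM : ∀ ω, |φ ω| ≤ M) :
    Integrable (fun θ => θ i * ∫ ω, φ ω ∂(P.law σ θ)) (Measure.pi fun _ : Fin d => prior h ε) ∧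
    Integrable (fun θ => ∫ ω, φ ω * dataScore σ θ i ω.2.2 ∂(P.law σ θ))
      (Measure.pi fun _ : Fin d => prior h ε) ∧
    ∫ θ, θ i * ∫ ω, φ ω ∂(P.law σ θ) ∂(Measure.pi fun _ : Fin d => prior h ε)
      ≤ 2 * h ^ 2 / ε * ∫ θ, |∫ ω, φ ω * dataScore σ θ i ω.2.2 ∂(P.law σ θ)|
          ∂(Measure.pi fun _ : Fin d => prior h ε) := by
  set ν := prior h ε with hν
  set F : (Fin d → ℝ) → ℝ := fun θ => ∫ ω, φ ω ∂(P.law σ θ) with hF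
  set G : (Fin d → ℝ) → ℝ := fun θ => ∫ ω, φ ω * dataScore σ θ i ω.2.2 ∂(P.law σ θ) with hG
  set C : ℝ := m * (2 * Real.exp ((n : ℝ) / (σ : ℝ) ^ 2 / 2)) with hC
  have hFm : Measurable F := P.measurable_integral_law hσ (f := fun _ => φ) (hφ.comp measurable_snd)
  have hGm : Measurable G := P.measurable_integral_law hσ
    (f := fun θ ω => φ ω * dataScore σ θ i ω.2.2)
    ((hφ.comp measurable_snd).mul (P.measurable_score σ i))
  have hFb : ∀ θ, ‖F θ‖ ≤ M := fun θ => by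
    simpa using norm_integral_le_of_norm_le_const (μ := P.law σ θ) (f := φ)
      (Filter.Eventually.of_forall hM)
  have hGb : ∀ θ, ‖G θ‖ ≤ M * C := fun θ => by
    calc ‖G θ‖ ≤ ∫ ω, ‖φ ω * dataScore σ θ i ω.2.2‖ ∂(P.law σ θ) :=
          norm_integral_le_integral_norm _
      _ ≤ ∫ ω, M * |dataScore σ θ i ω.2.2| ∂(P.law σ θ) := by
          refine integral_mono_of_nonneg (Filter.Eventually.of_forall fun ω => norm_nonneg _)
            ((P.integrable_score hσ θ i).abs.const_mul M)
            (Filter.Eventually.of_forall fun ω => ?_)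
          simp only [norm_mul, Real.norm_eq_abs]
          exact mul_le_mul_of_nonneg_right (hM ω) (abs_nonneg _)
      _ = M * ∫ ω, |dataScore σ θ i ω.2.2| ∂(P.law σ θ) := integral_const_mul _ _
      _ ≤ M * C := by gcongr; exact P.integral_abs_score_le hσ θ i
  have hiG : Integrable G (Measure.pi fun _ : Fin d => ν) :=
    Integrable.of_bound hGm.aestronglyMeasurable (M * C) (Filter.Eventually.of_forall hGb)
  have hiF : Integrable (fun θ => θ i * F θ) (Measure.pi fun _ : Fin d => ν) := by
    refine Integrable.of_bound ((measurable_pi_apply i).mul hFm).aestronglyMeasurable (h * M) ?_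
    filter_upwards [ae_mem_pi_prior (d := d) hh] with θ hθ
    rw [norm_mul]
    exact mul_le_mul (abs_le.2 (hθ i)) (hFb θ) (norm_nonneg _) hh.le
  refine ⟨hiF, hiG, ?_⟩
  obtain ⟨hF1, hF2⟩ := integral_pi_eq_integral_update ν i hiF
  obtain ⟨hG1, hG2⟩ := integral_pi_eq_integral_update ν i hiG.abs
  rw [hF2, hG2, ← integral_const_mul]
  refine integral_mono_ae hF1.integral_prod_left (hG1.integral_prod_left.const_mul _) ?_
  filter_upwards with θ
  have hupd : Measurable fun t : ℝ => Function.update θ i t :=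
    (continuous_const.update i continuous_id).measurable
  simp only [Function.update_self]
  refine integral_id_mul_le hh hε (F := fun t => F (Function.update θ i t))
    (G := fun t => G (Function.update θ i t)) (fun t _ => ?_) ?_ ?_ ?_
  · exact P.integral_law_update_sub hσ θ i hφ hM0 hM (-h) t
  · refine Integrable.of_bound (measurable_id.mul (hFm.comp hupd)).aestronglyMeasurable (h * M) ?_
    filter_upwards [ae_mem_prior hh] with t ht
    change ‖t * F (Function.update θ i t)‖ ≤ h * M
    rw [norm_mul]
    exact mul_le_mul (abs_le.2 ht) (hFb _) (norm_nonneg _) hh.le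
  · exact Integrable.of_bound (hGm.comp hupd).aestronglyMeasurable (M * C)
      (Filter.Eventually.of_forall fun t => hGb _)
  · exact Measure.integrableOn_of_bounded (by simp) (hGm.comp hupd).aestronglyMeasurable
      (M := M * C) (Filter.Eventually.of_forall fun t => hGb _)

/-! ### The Bayes risk bound and the limit of no truncation. -/

theorem integral_sum_sq_sub_eq (est : List Bool → Fin d → ℝ) (σ : ℝ≥0) (θ : Fin d → ℝ) (k : ℕ) :
    ∫ ω, ∑ i, (P.truncEst est k i ω - θ i) ^ 2 ∂(P.law σ θ)
      = ∑ i, (∫ ω, P.truncEst est k i ω ^ 2 ∂(P.law σ θ)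
          - 2 * (θ i * ∫ ω, P.truncEst est k i ω ∂(P.law σ θ)) + θ i ^ 2) := by
  obtain ⟨M, hM⟩ := P.exists_abs_truncEst_le est k
  have h1 : ∀ i, Integrable (P.truncEst est k i) (P.law σ θ) := fun i =>
    Integrable.of_bound (P.measurable_truncEst est k i).aestronglyMeasurable M
      (Filter.Eventually.of_forall (hM i))
  have h2 := P.integrable_truncEst_sq est σ θ k
  have h3 : ∀ i, Integrable (fun ω => P.truncEst est k i ω ^ 2 - 2 * θ i * P.truncEst est k i ω)
      (P.law σ θ) := fun i => (h2 i).sub ((h1 i).const_mul _)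
  have e : ∀ i ω, (P.truncEst est k i ω - θ i) ^ 2
      = P.truncEst est k i ω ^ 2 - 2 * θ i * P.truncEst est k i ω + θ i ^ 2 := fun i ω => by ring
  simp only [e]
  have h4 : ∀ i, Integrable (fun ω => P.truncEst est k i ω ^ 2 - 2 * θ i * P.truncEst est k i ω
      + θ i ^ 2) (P.law σ θ) := fun i => (h3 i).add (integrable_const _)
  rw [integral_finsetSum _ fun i _ => h4 i]
  refine Finset.sum_congr rfl fun i _ => ?_
  rw [integral_add (h3 i) (integrable_const _), integral_sub (h2 i) ((h1 i).const_mul _),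
    integral_const_mul, integral_const, probReal_univ, one_smul, mul_assoc]

/-- Expanding the square, the only negative term is twice the correlation of θ with the estimate.
The Stein inequality followed by the information bound makes this at most ∑ E[est_i²] + 2VK²B with K
= 2h²/ε, and the second moments cancel. -/
theorem bayes_lower_bound (est : List Bool → Fin d → ℝ) {σ : ℝ≥0} (hσ : 0 < σ) (hn : 1 ≤ n)
    (k : ℕ) (hh : 0 < h) (hh1 : h ≤ 1) (hε : 0 < ε) (hε1 : ε ≤ 1) (hB : P.commCost σ ≠ ∞) {r : ℝ}
    (hr : ∀ θ ∈ Set.Icc (-1 : Fin d → ℝ) 1,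
      ∫ ω, ∑ i, (P.truncEst est k i ω - θ i) ^ 2 ∂(P.law σ θ) ≤ r) :
    d * ((1 - ε) * h ^ 2) - 8 * h ^ 4 / ε ^ 2 * (n / (σ : ℝ) ^ 2) * (P.commCost σ).toReal ≤ r := by
  have hprob := isProbabilityMeasure_prior hh hε hε1
  set π := Measure.pi fun _ : Fin d => prior h ε with hπ
  obtain ⟨M', hM'⟩ := P.exists_abs_truncEst_le est k
  set M := max M' 0
  have hM0 : 0 ≤ M := le_max_right _ _
  have hM : ∀ i ω, |P.truncEst est k i ω| ≤ M := fun i ω => (hM' i ω).trans (le_max_left _ _)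
  have hS := fun i => P.integral_mul_integral_law_le hσ hh hε i (P.measurable_truncEst est k i)
    hM0 (hM i)
  rw [← hπ] at hS
  set H : Fin d → (Fin d → ℝ) → ℝ := fun i θ => ∫ ω, P.truncEst est k i ω ∂(P.law σ θ)
  set G : Fin d → (Fin d → ℝ) → ℝ := fun i θ =>
    ∫ ω, P.truncEst est k i ω * dataScore σ θ i ω.2.2 ∂(P.law σ θ)
  set N : Fin d → (Fin d → ℝ) → ℝ := fun i θ => ∫ ω, P.truncEst est k i ω ^ 2 ∂(P.law σ θ)
  set B := (P.commCost σ).toReal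
  have hcube : ∀ᵐ θ ∂π, θ ∈ Set.Icc (-1 : Fin d → ℝ) 1 := by
    filter_upwards [ae_mem_pi_prior (d := d) hh] with θ hθ
    refine ⟨fun i => ?_, fun i => ?_⟩
    · have := (hθ i).1; simp only [Pi.neg_apply, Pi.one_apply]; linarith
    · have := (hθ i).2; simp only [Pi.one_apply]; linarith
  have hNi : ∀ i, Integrable (N i) π := fun i => by
    refine Integrable.of_bound (P.measurable_integral_law hσ
      (f := fun _ ω => P.truncEst est k i ω ^ 2)
      (((P.measurable_truncEst est k i).pow_const 2).comp measurable_snd)).aestronglyMeasurable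
      (M ^ 2) (Filter.Eventually.of_forall fun θ => ?_)
    have := norm_integral_le_of_norm_le_const (μ := P.law σ θ)
      (f := fun ω => P.truncEst est k i ω ^ 2) (C := M ^ 2)
      (Filter.Eventually.of_forall fun ω => by
        rw [norm_pow]; exact pow_le_pow_left₀ (norm_nonneg _) (hM i ω) 2)
    simpa using this
  have hsq : ∀ i, Integrable (fun θ : Fin d → ℝ => θ i ^ 2) π := fun i =>
    integrable_comp_eval (μ := fun _ : Fin d => prior h ε) (i := i) (f := fun t => t ^ 2)
      (integrable_prior_of_continuous hh (continuous_pow 2))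
  have hsq' : ∀ i, (1 - ε) * h ^ 2 ≤ ∫ θ, θ i ^ 2 ∂π := fun i => by
    refine (le_integral_sq_prior hh hε1).trans (le_of_eq ?_)
    exact (integral_comp_eval (μ := fun _ : Fin d => prior h ε) (i := i) (f := fun t => t ^ 2)
      (continuous_pow 2).aestronglyMeasurable).symm
  have hNH : ∀ i, Integrable (fun θ => N i θ - 2 * (θ i * H i θ)) π := fun i =>
    (hNi i).sub ((hS i).1.const_mul 2)
  have hterm : ∀ i, Integrable (fun θ => N i θ - 2 * (θ i * H i θ) + θ i ^ 2) π := fun i =>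
    (hNH i).add (hsq i)
  have hrisk : ∑ i, (∫ θ, N i θ ∂π - 2 * ∫ θ, θ i * H i θ ∂π + ∫ θ, θ i ^ 2 ∂π) ≤ r := by
    have h1 : ∫ θ, ∑ i, (N i θ - 2 * (θ i * H i θ) + θ i ^ 2) ∂π ≤ ∫ _θ, r ∂π := by
      refine integral_mono_ae (integrable_finsetSum _ fun i _ => hterm i) (integrable_const _) ?_
      filter_upwards [hcube] with θ hθ
      rw [← P.integral_sum_sq_sub_eq est σ θ k]
      exact hr θ hθ
    rw [integral_const, probReal_univ, one_smul, integral_finsetSum _ fun i _ => hterm i] at h1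
    refine le_trans (le_of_eq (Finset.sum_congr rfl fun i _ => ?_)) h1
    rw [integral_add (hNH i) (hsq i), integral_sub (hNi i) ((hS i).1.const_mul 2),
      integral_const_mul]
  set K : ℝ := 2 * h ^ 2 / ε with hK
  have hKpos : 0 < K := by positivity
  set V : ℝ := (n : ℝ) / (σ : ℝ) ^ 2 with hV
  have hV0 : 0 ≤ V := by positivity
  have hfisher : ∑ i, ∫ θ, |G i θ| ∂π ≤ 1 / K / 2 * ∑ i, ∫ θ, N i θ ∂π + V * K * B := by
    have h1 : ∫ θ, ∑ i, |G i θ| ∂π ≤ ∫ θ, (1 / K / 2 * ∑ i, N i θ + V * K * B) ∂π := by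
      refine integral_mono_ae (integrable_finsetSum _ fun i _ => (hS i).2.1.abs)
        (((integrable_finsetSum _ fun i _ => hNi i).const_mul _).add (integrable_const _)) ?_
      filter_upwards [hcube] with θ hθ
      -- Signs may depend on θ, because the information bound is applied for each θ separately; they
      -- produce the absolute values that the Stein inequality needs.
      let e : Fin d → ℝ := fun i => if 0 ≤ G i θ then 1 else -1
      have he : ∀ i, e i ^ 2 = 1 := fun i => by simp only [e]; split_ifs <;> norm_num
      have heG : ∀ i, |G i θ| = e i * G i θ := fun i => by
        simp only [e]; split_ifs with hi
        · rw [abs_of_nonneg hi, one_mul]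
        · rw [abs_of_neg (not_le.1 hi), neg_one_mul]
      -- With a = 1/K, multiplying by 2K turns the coefficient a/2 of the second moments into 1, as
      -- the cancellation requires.
      have h2 := P.integral_truncEst_mul_dataScore_le est hσ hn θ k he (a := 1 / K) (by positivity)
      simp only [heG]
      refine h2.trans (add_le_add_right ?_ _)
      have h3 := P.integral_length_board_le hθ hB k
      have h4 : 0 ≤ ∫ ω, ((P.board ω k).length : ℝ) ∂(P.law σ θ) :=
        integral_nonneg fun ω => Nat.cast_nonneg (P.board ω k).length
      calc V / (1 / K) * Real.log 2 * ∫ ω, ((P.board ω k).length : ℝ) ∂(P.law σ θ)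
          ≤ V / (1 / K) * 1 * B := by
            gcongr
            have := Real.log_two_lt_d9; linarith
        _ = V * K * B := by rw [div_div_eq_mul_div]; ring
    rw [integral_finsetSum _ fun i _ => (hS i).2.1.abs, integral_add
      ((integrable_finsetSum _ fun i _ => hNi i).const_mul _) (integrable_const _),
      integral_const_mul, integral_finsetSum _ fun i _ => hNi i, integral_const, probReal_univ,
      one_smul] at h1
    exact h1
  have hstein : ∑ i, ∫ θ, θ i * H i θ ∂π ≤ K * ∑ i, ∫ θ, |G i θ| ∂π := by
    rw [Finset.mul_sum]
    exact Finset.sum_le_sum fun i _ => (hS i).2.2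
  have hvar : d * ((1 - ε) * h ^ 2) ≤ ∑ i, ∫ θ, θ i ^ 2 ∂π := by
    have := Finset.sum_le_sum fun i (_ : i ∈ Finset.univ) => hsq' i
    simpa using this
  rw [Finset.sum_add_distrib, Finset.sum_sub_distrib, ← Finset.mul_sum] at hrisk
  have h3 := mul_le_mul_of_nonneg_left hfisher hKpos.le
  have h4 : K * (1 / K / 2 * ∑ i, ∫ θ, N i θ ∂π + V * K * B)
      = (∑ i, ∫ θ, N i θ ∂π) / 2 + V * K ^ 2 * B := by field_simp
  have h5 : 8 * h ^ 4 / ε ^ 2 * V * B = 2 * (V * K ^ 2 * B) := by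
    rw [hK]; field_simp; ring
  rw [h5]
  linarith

theorem loss_lower_bound (est : List Bool → Fin d → ℝ) {σ : ℝ≥0} (hσ : 0 < σ) (hn : 1 ≤ n)
    (hh : 0 < h) (hh1 : h ≤ 1) (hε : 0 < ε) (hε1 : ε ≤ 1) (hB : P.commCost σ ≠ ∞)
    (hR : P.loss est σ ≠ ∞) :
    d * ((1 - ε) * h ^ 2) - 8 * h ^ 4 / ε ^ 2 * (n / (σ : ℝ) ^ 2) * (P.commCost σ).toReal
      ≤ (P.loss est σ).toReal := by
  set B := (P.commCost σ).toReal
  set R := (P.loss est σ).toReal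
  have key : ∀ k : ℕ, 0 < k →
      d * ((1 - ε) * h ^ 2) - 8 * h ^ 4 / ε ^ 2 * (n / (σ : ℝ) ^ 2) * B ≤ R + d * B / k := by
    intro k hk
    refine P.bayes_lower_bound est hσ hn k hh hh1 hε hε1 hB fun θ hθ => ?_
    have h1 := P.lintegral_truncEst_le est (σ := σ) hθ hk
    have hdk : (d / k : ℝ≥0∞) ≠ ∞ :=
      ENNReal.div_ne_top (ENNReal.natCast_ne_top d) (by exact_mod_cast hk.ne')
    have hfin : (d / k : ℝ≥0∞) * P.commCost σ ≠ ∞ := ENNReal.mul_ne_top hdk hB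
    rw [integral_eq_lintegral_of_nonneg_ae
      (Filter.Eventually.of_forall fun ω => Finset.sum_nonneg fun i _ => sq_nonneg _)
      (Finset.measurable_sum _ fun i _ =>
        ((P.measurable_truncEst est k i).sub_const _).pow_const 2).aestronglyMeasurable]
    refine (ENNReal.toReal_mono (ENNReal.add_ne_top.2 ⟨hR, hfin⟩) h1).trans (le_of_eq ?_)
    rw [ENNReal.toReal_add hR hfin, ENNReal.toReal_mul, ENNReal.toReal_div,
      ENNReal.toReal_natCast, ENNReal.toReal_natCast]
    ring
  have hlim : Filter.Tendsto (fun k : ℕ => R + d * B / k) Filter.atTop (nhds (R + 0)) :=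
    (tendsto_const_div_atTop_nhds_zero_nat (d * B)).const_add R
  rw [add_zero] at hlim
  exact ge_of_tendsto hlim (Filter.eventually_atTop.2 ⟨1, fun k hk => key k hk⟩)

end Protocol

/-! ### Choice of the scale of the prior. -/

theorem half_le_log {m : ℕ} (hm : 2 ≤ m) : (1 : ℝ) / 2 ≤ Real.log m := by
  have h1 : Real.log 2 ≤ Real.log m :=
    Real.log_le_log (by norm_num) (by exact_mod_cast hm)
  have := Real.log_two_gt_d9
  linarith

namespace Protocol

variable {m n d : ℕ} (P : Protocol m n d)

theorem loss_ge_of_commCost_ne_top (est : List Bool → Fin d → ℝ) {σ : ℝ≥0} (hσ : 0 < σ) (hn : 1 ≤ n)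
    (hB : P.commCost σ ≠ ∞) (hR : P.loss est σ ≠ ∞) :
    (P.loss est σ).toReal ≥ d / 8 ∨ 0 < (P.commCost σ).toReal ∧
      (P.loss est σ).toReal
        ≥ (d : ℝ) ^ 2 * (σ : ℝ) ^ 2 / (n * (P.commCost σ).toReal) / 512 := by
  set B := (P.commCost σ).toReal
  have hσ' : (0 : ℝ) < σ := NNReal.coe_pos.2 hσ
  have hn' : (0 : ℝ) < n := Nat.cast_pos.2 hn
  have hd : (0 : ℝ) ≤ d := Nat.cast_nonneg d
  have hB0 : 0 ≤ B := ENNReal.toReal_nonneg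
  set T : ℝ := n / (σ : ℝ) ^ 2 * B with hT
  have key : ∀ h : ℝ, 0 < h → h ≤ 1 →
      d * h ^ 2 / 2 - 32 * h ^ 4 * T ≤ (P.loss est σ).toReal := fun h hh hh1 => by
    have := P.loss_lower_bound est hσ hn hh hh1 (ε := 1 / 2) (by norm_num) (by norm_num) hB hR
    refine le_trans (le_of_eq ?_) this
    rw [hT]; ring
  -- With few bits, h = 1 gives d/2 − 32T ≥ d/8. Otherwise the maximiser h² = d/(128T) of dh²/2 −
  -- 32h⁴T is below 2/3, hence admissible, and gives d²/(512T).
  by_cases hc : 256 * T ≤ 3 * d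
  · left
    have := key 1 one_pos le_rfl
    linarith
  · right
    have hTpos : 0 < T := by nlinarith
    have hBpos : 0 < B := by
      rcases hB0.lt_or_eq with h | h
      · exact h
      · rw [hT, ← h, mul_zero] at hTpos; exact absurd hTpos (lt_irrefl _)
    refine ⟨hBpos, ?_⟩
    have hval : (d : ℝ) ^ 2 * (σ : ℝ) ^ 2 / (n * B) = d ^ 2 / T := by
      rw [hT]; field_simp
    rw [hval]
    rcases hd.lt_or_eq with hd | hd
    · set h : ℝ := √(d / (128 * T)) with hh
      have hpos : 0 < (d : ℝ) / (128 * T) := by positivity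
      have hsq : h ^ 2 = d / (128 * T) := Real.sq_sqrt hpos.le
      have h1 : h ≤ 1 := by
        rw [hh, Real.sqrt_le_one, div_le_one (by positivity)]
        linarith
      have := key h (Real.sqrt_pos.2 hpos) h1
      have e : (h ^ 4 : ℝ) = (d / (128 * T)) ^ 2 := by rw [← hsq]; ring
      rw [e, hsq] at this
      refine le_trans (le_of_eq ?_) this
      field_simp
      ring
    · rw [← hd]
      simp

end Protocol

end DistributedMean

/-! ### The two claims in extended nonnegative reals. -/

theorem corollary2 :
    (∃ c : ℝ, 0 < c ∧
      ∀ (m n d : ℕ) (σ : ℝ≥0), 2 ≤ m → 1 ≤ n → 1 ≤ d → 0 < σ →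
        ∀ (P : DistributedMean.Protocol m n d) (est : List Bool → Fin d → ℝ),
          ENNReal.ofReal c *
              min
                (min
                  ((d : ℝ≥0∞) ^ 2 * (σ : ℝ≥0∞) ^ 2 /
                    ((n : ℝ≥0∞) * P.commCost σ * ENNReal.ofReal (Real.log m)))
                  ((d : ℝ≥0∞) * (σ : ℝ≥0∞) ^ 2 / ((n : ℝ≥0∞) * ENNReal.ofReal (Real.log m))))
                (d : ℝ≥0∞)
            ≤ P.loss est σ) ∧
    (∀ κ : ℝ, 0 < κ → κ < 1 → ∃ c : ℝ, 0 < c ∧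
      ∀ (m n d : ℕ) (σ : ℝ≥0), 2 ≤ m → 1 ≤ n → 1 ≤ d → 0 < σ →
        (σ : ℝ) ^ 2 ≤ κ * (m * n) →
        ∀ (P : DistributedMean.Protocol m n d) (est : List Bool → Fin d → ℝ),
          P.loss est σ ≤ ENNReal.ofReal (d * (σ : ℝ) ^ 2 / (m * n)) →
            ENNReal.ofReal (c * (d * m / Real.log m)) ≤ P.commCost σ) := by
  constructor
  · refine ⟨1 / 1024, by norm_num, fun m n d σ hm hn hd hσ P est => ?_⟩
    have hlog := DistributedMean.half_le_log hm
    have hn' : (0 : ℝ) < n := Nat.cast_pos.2 hn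
    have hlogpos : 0 < ENNReal.ofReal (Real.log m) := ENNReal.ofReal_pos.2 (by linarith)
    by_cases hR : P.loss est σ = ∞
    · rw [hR]; exact le_top
    by_cases hB : P.commCost σ = ∞
    · have h0 : (n : ℝ≥0∞) * P.commCost σ * ENNReal.ofReal (Real.log m) = ∞ := by
        rw [hB, ENNReal.mul_top (by exact_mod_cast (by omega : n ≠ 0)),
          ENNReal.top_mul hlogpos.ne']
      rw [h0, ENNReal.div_top]
      simp
    rw [← ENNReal.ofReal_toReal hR]
    rcases P.loss_ge_of_commCost_ne_top est hσ hn hB hR with h | ⟨hBpos, h⟩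
    · refine (mul_le_mul_right (min_le_right _ _) _).trans ?_
      rw [← ENNReal.ofReal_natCast d, ← ENNReal.ofReal_mul (by norm_num)]
      refine ENNReal.ofReal_le_ofReal (le_trans ?_ h)
      have : (0 : ℝ) ≤ d := Nat.cast_nonneg d
      linarith
    · refine (mul_le_mul_right ((min_le_left _ _).trans (min_le_left _ _)) _).trans ?_
      set B := (P.commCost σ).toReal with hBdef
      have e : (d : ℝ≥0∞) ^ 2 * (σ : ℝ≥0∞) ^ 2 /
          ((n : ℝ≥0∞) * P.commCost σ * ENNReal.ofReal (Real.log m))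
          = ENNReal.ofReal ((d : ℝ) ^ 2 * (σ : ℝ) ^ 2 / (n * B * Real.log m)) := by
        rw [ENNReal.ofReal_div_of_pos (by positivity), ENNReal.ofReal_mul (by positivity),
          ENNReal.ofReal_mul (by positivity), ENNReal.ofReal_mul hn'.le,
          ENNReal.ofReal_pow (by positivity), ENNReal.ofReal_pow (by positivity),
          ENNReal.ofReal_natCast, ENNReal.ofReal_natCast, ENNReal.ofReal_coe_nnreal,
          hBdef, ENNReal.ofReal_toReal hB]
      rw [e, ← ENNReal.ofReal_mul (by norm_num)]
      refine ENNReal.ofReal_le_ofReal (le_trans ?_ h)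
      -- Using log m ≥ 1/2 loses a factor 2, which turns 1/512 into 1/1024.
      have h1 : (d : ℝ) ^ 2 * (σ : ℝ) ^ 2 / (n * B * Real.log m)
          ≤ (d : ℝ) ^ 2 * (σ : ℝ) ^ 2 / (n * B * (1 / 2)) := by gcongr
      have h2 : (d : ℝ) ^ 2 * (σ : ℝ) ^ 2 / (n * B * (1 / 2))
          = 2 * ((d : ℝ) ^ 2 * (σ : ℝ) ^ 2 / (n * B)) := by field_simp
      rw [h2] at h1
      linarith
  · intro κ hκ hκ1
    -- This makes (1 − ε)/κ − 1 = (1 − κ)/(2κ) positive, so with h² = τ/κ the prior variance exceeds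
    -- the permitted loss τ per coordinate by a fixed proportion; B must compensate for the gap.
    set ε : ℝ := (1 - κ) / 2 with hε
    have hεpos : 0 < ε := by rw [hε]; linarith
    refine ⟨κ * (1 - κ) * ε ^ 2 / 32,
      by have : 0 < 1 - κ := by linarith
         positivity, fun m n d σ hm hn hd hσ hσκ P est hloss => ?_⟩
    have hlog := DistributedMean.half_le_log hm
    by_cases hB : P.commCost σ = ∞
    · rw [hB]; exact le_top
    have hR : P.loss est σ ≠ ∞ := ne_top_of_le_ne_top ENNReal.ofReal_ne_top hloss
    have hσ' : (0 : ℝ) < σ := NNReal.coe_pos.2 hσ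
    have hn' : (0 : ℝ) < n := Nat.cast_pos.2 hn
    have hm' : (0 : ℝ) < m := Nat.cast_pos.2 (by omega)
    have hd' : (0 : ℝ) < d := Nat.cast_pos.2 hd
    set B := (P.commCost σ).toReal with hBdef
    set τ : ℝ := (σ : ℝ) ^ 2 / (m * n) with hτ
    have hτpos : 0 < τ := by positivity
    have hτκ : τ / κ ≤ 1 := by
      rw [div_le_one hκ, hτ, div_le_iff₀ (by positivity)]; exact hσκ
    have hsq : √(τ / κ) ^ 2 = τ / κ := Real.sq_sqrt (by positivity)
    have hfour : √(τ / κ) ^ 4 = (τ / κ) ^ 2 := by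
      rw [show (4 : ℕ) = 2 * 2 from rfl, pow_mul, hsq]
    have key := P.loss_lower_bound est hσ hn (h := √(τ / κ)) (Real.sqrt_pos.2 (by positivity))
      (Real.sqrt_le_one.2 hτκ) hεpos (by rw [hε]; linarith) hB hR
    have hloss' : (P.loss est σ).toReal ≤ d * τ := by
      have := ENNReal.toReal_mono ENNReal.ofReal_ne_top hloss
      rw [ENNReal.toReal_ofReal (by positivity)] at this
      rw [hτ, ← mul_div_assoc]; exact this
    have hmain := key.trans hloss'
    rw [hsq, hfour] at hmain
    have hnσ : (n : ℝ) / (σ : ℝ) ^ 2 = 1 / (τ * m) := by rw [hτ]; field_simp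
    rw [hnσ, ← hBdef] at hmain
    have h1 : κ * (1 - κ) * ε ^ 2 / 16 * (d * m) ≤ B := by
      have e1 : 8 * (τ / κ) ^ 2 / ε ^ 2 * (1 / (τ * m)) * B
          = τ / κ * (8 * B / (ε ^ 2 * κ * m)) := by field_simp
      have e2 : d * ((1 - ε) * (τ / κ)) - d * τ = τ / κ * (d * (1 - κ) / 2) := by
        rw [hε]; field_simp; ring
      have h2 : τ / κ * (d * (1 - κ) / 2) ≤ τ / κ * (8 * B / (ε ^ 2 * κ * m)) := by
        rw [← e1, ← e2]; linarith
      have h3 := le_of_mul_le_mul_left h2 (by positivity)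
      rw [le_div_iff₀ (by positivity)] at h3
      linarith
    rw [← ENNReal.ofReal_toReal hB]
    refine ENNReal.ofReal_le_ofReal (le_trans ?_ h1)
    have h2 : d * m / Real.log m ≤ d * m / (1 / 2) := by gcongr
    calc κ * (1 - κ) * ε ^ 2 / 32 * (d * m / Real.log m)
        ≤ κ * (1 - κ) * ε ^ 2 / 32 * (d * m / (1 / 2)) := by
          have : 0 < 1 - κ := by linarith
          gcongr
      _ = _ := by ring
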